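/- Let $p\in(0,1)$ and write $p=\frac12-b$. For integers $n\ge 2$ and $m\ge 0$, let $\Phi_2^p(m,n)$ be the conjunction of $m$ independent random clauses on the Boolean variables $x_1,\dots,x_n$, each generated as follows: choose a set of two variables uniformly at random among all $2$-subsets of $\{x_1,\dots,x_n\}$; then, independently for each chosen variable $x$, take the literal $x$ with probability $p$ and the literal $\neg x$ with probability $1-p$; the clause is the disjunction of the two literals. Put $$\alpha_2(p,n):=\inf\left\{\tfrac mn : m\in\mathbb{Z}_{\ge 0},\ \Pr\big(\Phi_2^p(m,n)\text{ is satisfiable}\big)\le\tfrac12\right\}.$$ **Theorem.** The biased random $2$-SAT problem with bias $p$ has a sharp satisfiability threshold at $$\alpha_2(p)=\frac{1}{4p(1-p)}=\frac{1}{1-4b^2}.$$ That is, for every $\varepsilon>0$ and every sequence $m=m(n)$ of non-negative integers: 1. if $m(n)\le(1-\varepsilon)\,\frac{n}{4p(1-p)}$ for all large $n$, then $\Pr\big(\Phi_2^p(m(n),n)\text{ is satisfiable}\big)\to1$ as $n\to\infty$; 2. if $m(n)\ge(1+\varepsilon)\,\frac{n}{4p(1-p)}$ for all large $n$, then $\Pr\big(\Phi_2^p(m(n),n)\text{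 is satisfiable}\big)\to0$ as $n\to\infty$. The same holds in the continuous-time model, in which $m(n)$ is replaced by a sequence of real numbers $t(n)\ge 0$ and the formula consists of a $\mathrm{Poisson}(t(n))$-distributed number of such clauses, independent of the clauses. Moreover $\lim_{n\to\infty}\alpha_2(p,n)$ exists and equals $\frac{1}{4p(1-p)}$. -/

import Mathlib

open Filter Topology

open scoped NNReal

/-- A `k`-clause on the Boolean variables `x_i`, `i : Fin n`: a `k`-set of variables together with
a sign for each of them (`true` for the literal `x_i`, `false` for the literal `¬ x_i`). -/
abbrev KClause (k n : ℕ) : Type :=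
  (K : {K : Finset (Fin n) // K.card = k}) × (K.1 → Bool)

/-- The assignment `a` satisfies the disjunction `C`: some literal of `C` is true under `a`. -/
def KClause.SatisfiedBy {k n : ℕ} (C : KClause k n) (a : Fin n → Bool) : Prop :=
  ∃ x : C.1.1, a x.1 = C.2 x

/-- The conjunction of the clauses `F 0, …, F (m - 1)` is satisfiable. -/
def FormulaSatisfiable {k n m : ℕ} (F : Fin m → KClause k n) : Prop :=
  ∃ a : Fin n → Bool, ∀ j, (F j).SatisfiedBy a

/-- The probability that a `p`-biased random clause equals `C`: the variable set is uniform among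
the `k`-sets, and then each sign is independently positive with probability `p`. -/
noncomputable def clauseProb {k n : ℕ} (p : ℝ) (C : KClause k n) : ℝ :=
  ((n.choose k : ℝ))⁻¹ * ∏ x : C.1.1, if C.2 x = true then p else 1 - p

open Classical in
/-- The probability that the conjunction of `m` i.i.d. `p`-biased `k`-clauses on `n` variables is
satisfiable. -/
noncomputable def satProb (k n m : ℕ) (p : ℝ) : ℝ :=
  ∑ F : Fin m → KClause k n with FormulaSatisfiable F, ∏ j, clauseProb p (F j)

/-- The probability of satisfiability when the number of clauses is Poisson distributed with mean
`t` and independent of the clauses (that is, clauses arrive at the times of a rate-one Poisson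
process that is observed at time `t`). -/
noncomputable def satProbPoisson (k n : ℕ) (t : ℝ≥0) (p : ℝ) : ℝ :=
  ∑' m : ℕ, (Real.exp (-(t : ℝ)) * (t : ℝ) ^ m / (m.factorial : ℝ)) * satProb k n m p

/-- The density `α_k(p, n) = inf {m / n : Pr(Φ is satisfiable) ≤ 1 / 2}`. -/
noncomputable def medianDensity (k : ℕ) (p : ℝ) (n : ℕ) : ℝ :=
  sInf {α : ℝ | ∃ m : ℕ, α = (m : ℝ) / (n : ℝ) ∧ satProb k n m p ≤ 1 / 2}

/-- The number `α` is a sharp satisfiability threshold for `m` i.i.d. `p`-biased `k`-clauses on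
`n` variables, with respect to the density `m / n`. -/
def IsSharpSatThreshold (k : ℕ) (p α : ℝ) : Prop :=
  ∀ ε : ℝ, 0 < ε → ∀ m : ℕ → ℕ,
    ((∀ᶠ n : ℕ in atTop, (m n : ℝ) ≤ (1 - ε) * α * n) →
      Tendsto (fun n => satProb k n (m n) p) atTop (𝓝 1)) ∧
    ((∀ᶠ n : ℕ in atTop, (1 + ε) * α * n ≤ (m n : ℝ)) →
      Tendsto (fun n => satProb k n (m n) p) atTop (𝓝 0))

/-- The number `α` is a sharp satisfiability threshold in the Poissonized model, with respect to
the density `t / n`. -/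
def IsSharpSatThresholdPoisson (k : ℕ) (p α : ℝ) : Prop :=
  ∀ ε : ℝ, 0 < ε → ∀ t : ℕ → ℝ≥0,
    ((∀ᶠ n : ℕ in atTop, (t n : ℝ) ≤ (1 - ε) * α * n) →
      Tendsto (fun n => satProbPoisson k n (t n) p) atTop (𝓝 1)) ∧
    ((∀ᶠ n : ℕ in atTop, (1 + ε) * α * n ≤ (t n : ℝ)) →
      Tendsto (fun n => satProbPoisson k n (t n) p) atTop (𝓝 0))

/-- The clause probabilities add up to one. -/
theorem sum_clauseProb {k n : ℕ} (hkn : k ≤ n) (p : ℝ) :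
    ∑ C : KClause k n, clauseProb p C = 1 := by
  have h1 : ∀ K : {K : Finset (Fin n) // K.card = k},
      ∑ s : K.1 → Bool, clauseProb p (⟨K, s⟩ : KClause k n) = ((n.choose k : ℝ))⁻¹ := by
    intro K
    have h2 : ∑ s : K.1 → Bool, ∏ x : K.1, (if s x = true then p else 1 - p) = 1 := by
      have h3 := Finset.prod_univ_sum (fun _ : K.1 => (Finset.univ : Finset Bool))
        (fun _ b => if b = true then p else 1 - p)
      rw [Fintype.piFinset_univ] at h3
      rw [← h3]
      simp
    simp only [clauseProb]
    rw [← Finset.mul_sum, h2, mul_one]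
  have hcard : Fintype.card {K : Finset (Fin n) // K.card = k} = n.choose k := by
    simp
  have hne : (n.choose k : ℝ) ≠ 0 := by
    exact_mod_cast (Nat.choose_pos hkn).ne'
  rw [Fintype.sum_sigma]
  simp only [h1, Finset.sum_const, Finset.card_univ, hcard, nsmul_eq_mul]
  exact mul_inv_cancel₀ hne

/-! Write r = p(1 - p) and N = `n.choose 2`. A clause ¬l ∨ l' is an implication l → l', together
with its contrapositive ¬l' → ¬l, and a 2-SAT formula is unsatisfiable exactly when some literal and
its negation reach each other in the implication digraph. Along a path, an inner literal l is the
head of one implication and the tail of the next, so it contributes `litWeight p l * litWeight p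
(litNeg l)` = r whatever its sign. A further step therefore multiplies the expected number of paths
by about γ = 2n · r · m/N ≈ 4rm/n, and the threshold is the density at which γ = 1.

Below the threshold a first moment suffices. An unsatisfiable formula contains a walk through a
literal and its negation that stops at its first further repetition of a variable. It uses s + 1
distinct clauses but only s free literals, so the expected number of such walks is at most (m/N) ∑
2(s + 1)² γ^s, which is O(1/n) when γ stays below 1 (`exists_pattern_of_not_satisfiable`,
`one_sub_satProb_le`).

Above the threshold a second moment is applied to contradictory cycles ("snakes"): paths x → ⋯ → ¬x
and ¬x → ⋯ → x of length t ≈ n^(1/4) on distinct variables. Their expected number is about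
γ^(2t)/(2n), which is large. By Paley–Zygmund it is enough that, given one snake, the expected
number of snakes is at most (1 + o(1)) times the unconditional one. Dropping distinctness in the
second snake, this conditional expectation is bounded by ∑ₓ M^t(x, ¬x) M^t(¬x, x), where M = a · u
vᵀ + P, a = m/N, u(x) and v(x) are the weights of ¬x and x, and P counts the implications of the
given snake. The rank-one part alone gives the wanted main term. The powers of M are controlled by a
potential h with P h ≤ (1 + 1/t) h and total mass O(t) (`pow_rank_one_add_le`, `IsSnake.trace_le`),
so that all relative errors are O(t²/n).

Both bounds are uniform in m. Hence the Poisson model follows from Chebyshev's inequality, and the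
limit of the median density follows without any monotonicity in m. -/

/-! ### Products of independent finite random variables -/

section Independent

variable {Ω E ι : Type*} [DecidableEq E] [Fintype ι]

/-- The indicator of the event that the sample `F (σ i)` has type `e i` for all `i`. -/
def occurs {m : ℕ} (τ : Ω → E) (σ : ι → Fin m) (e : ι → E) (F : Fin m → Ω) : ℝ :=
  ∏ i, if τ (F (σ i)) = e i then 1 else 0

theorem occurs_nonneg {m : ℕ} (τ : Ω → E) (σ : ι → Fin m) (e : ι → E) (F : Fin m → Ω) :
    0 ≤ occurs τ σ e F :=
  Finset.prod_nonneg fun i _ => by split_ifs <;> norm_num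

theorem occurs_eq_one {m : ℕ} {τ : Ω → E} {σ : ι → Fin m} {e : ι → E} {F : Fin m → Ω}
    (h : ∀ i, τ (F (σ i)) = e i) : occurs τ σ e F = 1 :=
  Finset.prod_eq_one fun i _ => if_pos (h i)

theorem of_occurs_ne_zero {m : ℕ} {τ : Ω → E} {σ : ι → Fin m} {e : ι → E} {F : Fin m → Ω}
    (h : occurs τ σ e F ≠ 0) (i : ι) : τ (F (σ i)) = e i := by
  by_contra hi
  exact h (Finset.prod_eq_zero (Finset.mem_univ i) (if_neg hi))

/-- Independence acts on each place j separately, so products over pattern positions are regrouped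
by the place they look at; places that are not hit contribute 1. -/
theorem prod_fiber_eq {m : ℕ} (σ : ι → Fin m) (f : ι → Fin m → ℝ) :
    ∏ j, ∏ i, (if σ i = j then f i j else 1) = ∏ i, f i (σ i) := by
  rw [Finset.prod_comm]
  simp

theorem prod_ite_injective [DecidableEq ι] {m : ℕ} {σ : ι → Fin m} (hσ : σ.Injective) (i : ι)
    (f : ι → ℝ) : ∏ i', (if σ i' = σ i then f i' else 1) = f i := by
  simp [hσ.eq_iff]

theorem prod_ite_not_mem {m : ℕ} {σ : ι → Fin m} {j : Fin m} (hj : ∀ i, σ i ≠ j)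
    (f : ι → ℝ) : ∏ i', (if σ i' = j then f i' else 1) = 1 :=
  Finset.prod_eq_one fun i _ => if_neg (hj i)

theorem occurs_eq_prod {m : ℕ} (τ : Ω → E) (σ : ι → Fin m) (e : ι → E) (F : Fin m → Ω) :
    occurs τ σ e F = ∏ j, ∏ i, if σ i = j then (if τ (F j) = e i then 1 else 0) else 1 :=
  (prod_fiber_eq σ fun i j => if τ (F j) = e i then 1 else 0).symm

variable [Fintype Ω]

theorem sum_prod_mul_prod {m : ℕ} (q : Ω → ℝ) (g : Fin m → Ω → ℝ) :
    ∑ F : Fin m → Ω, (∏ j, q (F j)) * ∏ j, g j (F j) = ∏ j, ∑ C, q C * g j C := by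
  classical
  rw [Finset.prod_univ_sum, Fintype.piFinset_univ]
  simp only [Finset.prod_mul_distrib]

/-- The weight of the fibre of `τ` over `e`. -/
def fiberWeight (q : Ω → ℝ) (τ : Ω → E) (e : E) : ℝ :=
  ∑ C, q C * if τ C = e then 1 else 0

theorem fiberWeight_nonneg {q : Ω → ℝ} (hq : ∀ C, 0 ≤ q C) (τ : Ω → E) (e : E) :
    0 ≤ fiberWeight q τ e :=
  Finset.sum_nonneg fun C _ => mul_nonneg (hq C) (by split_ifs <;> norm_num)

theorem sum_mul_occurs {m : ℕ} {q : Ω → ℝ} (hq1 : ∑ C, q C = 1) (τ : Ω → E)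
    {σ : ι → Fin m} (hσ : σ.Injective) (e : ι → E) :
    ∑ F : Fin m → Ω, (∏ j, q (F j)) * occurs τ σ e F = ∏ i, fiberWeight q τ (e i) := by
  classical
  simp only [occurs_eq_prod]
  rw [sum_prod_mul_prod q fun j C => ∏ i, if σ i = j then (if τ C = e i then (1 : ℝ) else 0) else 1,
    ← prod_fiber_eq σ fun i _ => fiberWeight q τ (e i)]
  refine Finset.prod_congr rfl fun j _ => ?_
  by_cases hj : ∃ i, σ i = j
  · obtain ⟨i, rfl⟩ := hj
    rw [prod_ite_injective hσ i]
    simp only [prod_ite_injective hσ i fun i => if τ _ = e i then (1 : ℝ) else 0]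
    rfl
  · push Not at hj
    rw [prod_ite_not_mem hj]
    simp only [prod_ite_not_mem hj, mul_one, hq1]

/-- The expectation factorises over places. At a place hit by both patterns the factor is the weight
of the common type if the two types agree and 0 otherwise; either way it is at most the first weight
times (second weight + indicator of agreement). At all other places the events do not interact. -/
theorem sum_mul_occurs_mul_occurs_le {m : ℕ} {q : Ω → ℝ} (hq : ∀ C, 0 ≤ q C)
    (hq1 : ∑ C, q C = 1) (τ : Ω → E) {σ σ' : ι → Fin m} (hσ : σ.Injective)
    (hσ' : σ'.Injective) (e e' : ι → E) :
    ∑ F : Fin m → Ω, (∏ j, q (F j)) * (occurs τ σ e F * occurs τ σ' e' F) ≤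
      (∏ i, fiberWeight q τ (e i)) *
        ∏ i, (fiberWeight q τ (e' i) + ∑ i', if σ i' = σ' i ∧ e i' = e' i then 1 else 0) := by
  classical
  have hocc : ∀ F : Fin m → Ω, occurs τ σ e F * occurs τ σ' e' F =
      ∏ j, ((∏ i, if σ i = j then (if τ (F j) = e i then (1 : ℝ) else 0) else 1) *
      ∏ i, if σ' i = j then (if τ (F j) = e' i then (1 : ℝ) else 0) else 1) := fun F => by
    rw [occurs_eq_prod, occurs_eq_prod, Finset.prod_mul_distrib]
  simp only [hocc]
  have hQ := fiberWeight_nonneg hq τ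
  have hG : ∀ i j, 0 ≤ ∑ i', if σ i' = j ∧ e i' = e' i then (1 : ℝ) else 0 :=
    fun i j => Finset.sum_nonneg fun i' _ => by split_ifs <;> norm_num
  rw [sum_prod_mul_prod q fun j C =>
      (∏ i, if σ i = j then (if τ C = e i then (1 : ℝ) else 0) else 1) *
      ∏ i, if σ' i = j then (if τ C = e' i then (1 : ℝ) else 0) else 1,
    ← prod_fiber_eq σ fun i _ => fiberWeight q τ (e i),
    ← prod_fiber_eq σ' fun i j => fiberWeight q τ (e' i) +
      ∑ i', if σ i' = j ∧ e i' = e' i then 1 else 0, ← Finset.prod_mul_distrib]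
  refine Finset.prod_le_prod (fun j _ => Finset.sum_nonneg fun C _ => mul_nonneg (hq C)
    (mul_nonneg (Finset.prod_nonneg fun i _ => by split_ifs <;> norm_num)
      (Finset.prod_nonneg fun i _ => by split_ifs <;> norm_num))) fun j _ => ?_
  by_cases hj : ∃ i, σ i = j
  · obtain ⟨i, rfl⟩ := hj
    rw [prod_ite_injective hσ i]
    simp only [prod_ite_injective hσ i fun i => if τ _ = e i then (1 : ℝ) else 0]
    by_cases hj' : ∃ i', σ' i' = σ i
    · obtain ⟨i', hi'⟩ := hj'
      simp only [← hi']
      rw [prod_ite_injective hσ' i' fun i'' => fiberWeight q τ (e' i'') +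
        ∑ i''', if σ i''' = σ' i' ∧ e i''' = e' i'' then (1 : ℝ) else 0]
      simp only [prod_ite_injective hσ' i' fun i => if τ _ = e' i then (1 : ℝ) else 0]
      by_cases hee : e i = e' i'
      · have h1 : (1 : ℝ) ≤ ∑ i'', if σ i'' = σ' i' ∧ e i'' = e' i' then (1 : ℝ) else 0 := by
          calc (1 : ℝ) = if σ i = σ' i' ∧ e i = e' i' then (1 : ℝ) else 0 := by
                rw [if_pos ⟨hi'.symm, hee⟩]
            _ ≤ _ := Finset.single_le_sum
                (f := fun i'' => if σ i'' = σ' i' ∧ e i'' = e' i' then (1 : ℝ) else 0)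
                (fun i'' _ => by split_ifs <;> norm_num) (Finset.mem_univ i)
        calc ∑ C, q C * ((if τ C = e i then (1 : ℝ) else 0) * if τ C = e' i' then 1 else 0)
            = fiberWeight q τ (e i) := by
              refine Finset.sum_congr rfl fun C _ => ?_
              rw [hee]; split_ifs <;> simp
          _ ≤ _ := le_mul_of_one_le_right (hQ _) (by linarith [hQ (e' i')])
      · calc ∑ C, q C * ((if τ C = e i then (1 : ℝ) else 0) * if τ C = e' i' then 1 else 0)
            = 0 := by
              refine Finset.sum_eq_zero fun C _ => ?_
              by_cases h : τ C = e i
              · rw [if_neg (fun h' => hee (h.symm.trans h'))]; simp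
              · simp [h]
          _ ≤ _ := mul_nonneg (hQ _) (add_nonneg (hQ _) (hG _ _))
    · push Not at hj'
      rw [prod_ite_not_mem hj']
      simp only [prod_ite_not_mem hj', mul_one]
      exact le_rfl
  · push Not at hj
    rw [prod_ite_not_mem hj]
    simp only [prod_ite_not_mem hj, one_mul]
    by_cases hj' : ∃ i', σ' i' = j
    · obtain ⟨i', rfl⟩ := hj'
      rw [prod_ite_injective hσ' i' fun i'' => fiberWeight q τ (e' i'') +
        ∑ i''', if σ i''' = σ' i' ∧ e i''' = e' i'' then (1 : ℝ) else 0]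
      simp only [prod_ite_injective hσ' i' fun i => if τ _ = e' i then (1 : ℝ) else 0]
      exact le_add_of_nonneg_right (hG _ _)
    · push Not at hj'
      rw [prod_ite_not_mem hj']
      simp only [prod_ite_not_mem hj', mul_one, hq1, le_refl]

theorem sum_prod_eq_one {m : ℕ} {q : Ω → ℝ} (hq1 : ∑ C, q C = 1) :
    ∑ F : Fin m → Ω, ∏ j, q (F j) = 1 := by
  have h := sum_prod_mul_prod (m := m) q fun _ _ => 1
  simpa [hq1] using h

/-- The Paley–Zygmund bound for a finite weighted sum. -/
theorem sq_sum_le_sum_ne_zero_mul {S : Type*} [Fintype S] {W X : S → ℝ} (hW : ∀ F, 0 ≤ W F)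
    (A : S → Prop) [DecidablePred A] (hA : ∀ F, X F ≠ 0 → A F) :
    (∑ F, W F * X F) ^ 2 ≤ (∑ F with A F, W F) * ∑ F, W F * X F ^ 2 := by
  have h : ∑ F, W F * X F = ∑ F with A F, W F * X F := by
    rw [Finset.sum_filter]
    refine Finset.sum_congr rfl fun F _ => ?_
    split_ifs with hF
    · rfl
    · rw [of_not_not fun hX => hF (hA F hX), mul_zero]
  rw [h]
  calc _ ≤ (∑ F with A F, W F) * ∑ F with A F, W F * X F ^ 2 :=
        Finset.sum_sq_le_sum_mul_sum_of_sq_le_mul _ (fun F _ => hW F)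
          (fun F _ => mul_nonneg (hW F) (sq_nonneg _)) fun F _ => le_of_eq (by ring)
    _ ≤ _ := mul_le_mul_of_nonneg_left
        (Finset.sum_le_sum_of_subset_of_nonneg (Finset.filter_subset _ _)
          fun F _ _ => mul_nonneg (hW F) (sq_nonneg _)) (Finset.sum_nonneg fun F _ => hW F)

open Classical in
/-- The second moment method for the appearance of one of the patterns `e w`, `w : 𝒲`, in a
sequence of independent samples. -/
theorem second_moment_pattern {𝒲 : Type*} [Fintype 𝒲] {m : ℕ} {q : Ω → ℝ} (hq : ∀ C, 0 ≤ q C)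
    (hq1 : ∑ C, q C = 1) (τ : Ω → E) (e : 𝒲 → ι → E) {R : ℝ} (hR0 : 0 ≤ R)
    (hR : ∀ w, ∑ w', ∏ i, (m * fiberWeight q τ (e w' i) +
      ∑ i', if e w i' = e w' i then (1 : ℝ) else 0) ≤ R) :
    (m.descFactorial (Fintype.card ι)) * ∑ w, ∏ i, fiberWeight q τ (e w i) ≤
      (∑ F : Fin m → Ω with ∃ w, ∀ i, ∃ j, τ (F j) = e w i, ∏ j, q (F j)) * R := by
  have hQ := fiberWeight_nonneg hq τ
  set X : (Fin m → Ω) → ℝ := fun F => ∑ w, ∑ σ : ι ↪ Fin m, occurs τ σ (e w) F with hX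
  set W : (Fin m → Ω) → ℝ := fun F => ∏ j, q (F j) with hW
  have hW0 : ∀ F, 0 ≤ W F := fun F => Finset.prod_nonneg fun j _ => hq _
  have hX0 : ∀ F, 0 ≤ X F := fun F => Finset.sum_nonneg fun w _ => Finset.sum_nonneg
    fun σ _ => occurs_nonneg _ _ _ _
  set A : (Fin m → Ω) → Prop := fun F => ∃ w, ∀ i, ∃ j, τ (F j) = e w i with hA
  have hXA : ∀ F, X F ≠ 0 → A F := by
    intro F hF
    obtain ⟨w, -, hw⟩ := Finset.exists_ne_zero_of_sum_ne_zero hF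
    obtain ⟨σ, -, hσ⟩ := Finset.exists_ne_zero_of_sum_ne_zero hw
    exact ⟨w, fun i => ⟨σ i, of_occurs_ne_zero hσ i⟩⟩
  have hE : ∑ F, W F * X F =
      (m.descFactorial (Fintype.card ι)) * ∑ w, ∏ i, fiberWeight q τ (e w i) := by
    simp only [hX, Finset.mul_sum]
    rw [Finset.sum_comm]
    refine Finset.sum_congr rfl fun w _ => ?_
    rw [Finset.sum_comm]
    simp only [hW, sum_mul_occurs hq1 τ (Function.Embedding.injective _)]
    simp [Fintype.card_embedding_eq]
  -- Given one occurrence (w, σ), the sum over all second occurrences (w', σ') is at most R.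
  have hEX2 : ∑ F, W F * X F ^ 2 ≤ (∑ F, W F * X F) * R := by
    have h1 : ∑ F, W F * X F ^ 2 = ∑ w, ∑ σ : ι ↪ Fin m, ∑ w', ∑ σ' : ι ↪ Fin m,
        ∑ F, W F * (occurs τ σ (e w) F * occurs τ σ' (e w') F) := by
      have h2 : ∀ F, W F * X F ^ 2 = ∑ w, ∑ σ : ι ↪ Fin m, ∑ w', ∑ σ' : ι ↪ Fin m,
          W F * (occurs τ σ (e w) F * occurs τ σ' (e w') F) := by
        intro F
        rw [sq, hX]
        simp only [Finset.sum_mul, Finset.mul_sum]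
        refine Finset.sum_congr rfl fun w _ => Finset.sum_congr rfl fun σ _ =>
          Finset.sum_congr rfl fun w' _ => Finset.sum_congr rfl fun σ' _ => ?_
        rw [mul_comm (occurs τ σ' _ _)]
      simp only [h2]
      rw [Finset.sum_comm]
      refine Finset.sum_congr rfl fun w _ => ?_
      rw [Finset.sum_comm]
      refine Finset.sum_congr rfl fun σ _ => ?_
      rw [Finset.sum_comm]
      refine Finset.sum_congr rfl fun w' _ => ?_
      rw [Finset.sum_comm]
    rw [h1]
    have h3 : (∑ F, W F * X F) * R =
        ∑ w, ∑ _σ : ι ↪ Fin m, (∏ i, fiberWeight q τ (e w i)) * R := by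
      rw [hE]
      simp [Fintype.card_embedding_eq, Finset.mul_sum, Finset.sum_mul, mul_assoc]
    rw [h3]
    refine Finset.sum_le_sum fun w _ => Finset.sum_le_sum fun σ _ => ?_
    calc _ ≤ ∑ w', ∑ σ' : ι ↪ Fin m, (∏ i, fiberWeight q τ (e w i)) *
          ∏ i, (fiberWeight q τ (e w' i) +
            ∑ i', if σ i' = σ' i ∧ e w i' = e w' i then 1 else 0) :=
          Finset.sum_le_sum fun w' _ => Finset.sum_le_sum fun σ' _ =>
            sum_mul_occurs_mul_occurs_le hq hq1 τ σ.injective σ'.injective _ _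
      _ = (∏ i, fiberWeight q τ (e w i)) * ∑ w', ∑ σ' : ι ↪ Fin m,
          ∏ i, (fiberWeight q τ (e w' i) +
            ∑ i', if σ i' = σ' i ∧ e w i' = e w' i then 1 else 0) := by
          simp only [Finset.mul_sum]
      _ ≤ _ := by
          refine mul_le_mul_of_nonneg_left (le_trans (Finset.sum_le_sum fun w' _ => ?_) (hR w))
            (Finset.prod_nonneg fun i _ => hQ _)
          -- Once σ' ranges over all maps instead of injections, the sum over σ' of the product
          -- becomes a product over i of sums over places j.
          have h4 : ∀ i, ∑ j : Fin m, (fiberWeight q τ (e w' i) +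
              ∑ i', if σ i' = j ∧ e w i' = e w' i then (1 : ℝ) else 0) =
              m * fiberWeight q τ (e w' i) + ∑ i', if e w i' = e w' i then (1 : ℝ) else 0 := by
            intro i
            rw [Finset.sum_add_distrib, Finset.sum_comm]
            simp [ite_and]
          simp only [← h4]
          rw [Finset.prod_univ_sum, Fintype.piFinset_univ]
          have hinj : Function.Injective fun σ' : ι ↪ Fin m => (σ' : ι → Fin m) :=
            DFunLike.coe_injective
          rw [← Finset.sum_image (s := Finset.univ) (g := fun σ' : ι ↪ Fin m => (σ' : ι → Fin m))
            (f := fun σ' : ι → Fin m => ∏ i, (fiberWeight q τ (e w' i) +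
              ∑ i', if σ i' = σ' i ∧ e w i' = e w' i then (1 : ℝ) else 0)) hinj.injOn]
          refine Finset.sum_le_sum_of_subset_of_nonneg (Finset.subset_univ _) fun σ' _ _ => ?_
          exact Finset.prod_nonneg fun i _ => add_nonneg (hQ _)
            (Finset.sum_nonneg fun i' _ => by split_ifs <;> norm_num)
  have hEX0 : 0 ≤ ∑ F, W F * X F := Finset.sum_nonneg fun F _ => mul_nonneg (hW0 F) (hX0 F)
  have hP0 : 0 ≤ ∑ F with A F, W F := Finset.sum_nonneg fun F _ => hW0 F
  rw [← hE]
  -- If E X = 0 the claim is trivial; otherwise one factor E X cancels from (E X)² ≤ Pr(A) · E X ·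
  -- R.
  rcases hEX0.eq_or_lt with h | h
  · rw [← h]
    exact mul_nonneg hP0 hR0
  · have h5 := sq_sum_le_sum_ne_zero_mul hW0 A hXA
    have h6 := h5.trans (mul_le_mul_of_nonneg_left hEX2 hP0)
    refine le_of_mul_le_mul_right ?_ h
    nlinarith

open Classical in
/-- The first moment method for the appearance of a pattern at distinct places. -/
theorem first_moment_pattern {m : ℕ} {q : Ω → ℝ} (hq : ∀ C, 0 ≤ q C)
    (hq1 : ∑ C, q C = 1) (τ : Ω → E) (e : ι → E) :
    (∑ F : Fin m → Ω with ∃ σ : ι → Fin m, σ.Injective ∧ ∀ i, τ (F (σ i)) = e i,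
      ∏ j, q (F j)) ≤ ∏ i, (m * fiberWeight q τ (e i)) := by
  have hQ := fiberWeight_nonneg hq τ
  have hW0 : ∀ F : Fin m → Ω, 0 ≤ ∏ j, q (F j) := fun F => Finset.prod_nonneg fun j _ => hq _
  calc _ ≤ ∑ F : Fin m → Ω, ∑ σ : ι ↪ Fin m, (∏ j, q (F j)) * occurs τ σ e F := by
        rw [Finset.sum_filter]
        refine Finset.sum_le_sum fun F _ => ?_
        have h0 : ∀ σ ∈ (Finset.univ : Finset (ι ↪ Fin m)), 0 ≤ (∏ j, q (F j)) * occurs τ σ e F :=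
          fun σ _ => mul_nonneg (hW0 F) (occurs_nonneg _ _ _ _)
        split_ifs with h
        · obtain ⟨σ, hσ, hF⟩ := h
          have h1 := Finset.single_le_sum h0 (Finset.mem_univ ⟨σ, hσ⟩)
          have h2 : occurs τ (⟨σ, hσ⟩ : ι ↪ Fin m) e F = 1 := occurs_eq_one hF
          rwa [h2, mul_one] at h1
        · exact Finset.sum_nonneg h0
    _ = m.descFactorial (Fintype.card ι) * ∏ i, fiberWeight q τ (e i) := by
        rw [Finset.sum_comm]
        simp only [sum_mul_occurs hq1 τ (Function.Embedding.injective _)]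
        simp [Fintype.card_embedding_eq]
    _ ≤ _ := by
        rw [Finset.prod_mul_distrib, Finset.prod_const, Finset.card_univ]
        refine mul_le_mul_of_nonneg_right ?_ (Finset.prod_nonneg fun i _ => hQ _)
        exact_mod_cast Nat.descFactorial_le_pow _ _

end Independent

/-! ### Literals -/

/-- A literal: the pair `(v, s)` is true under `a` when `a v = s`. -/
abbrev Lit (n : ℕ) : Type := Fin n × Bool

/-- The negation of a literal. -/
def litNeg {n : ℕ} (l : Lit n) : Lit n := (l.1, !l.2)

@[simp] theorem litNeg_fst {n : ℕ} (l : Lit n) : (litNeg l).1 = l.1 := rfl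

@[simp] theorem litNeg_litNeg {n : ℕ} (l : Lit n) : litNeg (litNeg l) = l := by
  simp [litNeg]

theorem litNeg_injective {n : ℕ} : Function.Injective (litNeg (n := n)) :=
  Function.LeftInverse.injective litNeg_litNeg

theorem litNeg_ne {n : ℕ} (l : Lit n) : litNeg l ≠ l := by
  intro h
  have := congrArg Prod.snd h
  simp [litNeg] at this

theorem litNeg_eq_iff {n : ℕ} {l l' : Lit n} : litNeg l = l' ↔ l = litNeg l' := by
  constructor <;> rintro rfl <;> simp

theorem eq_or_eq_litNeg {n : ℕ} {l l' : Lit n} (h : l.1 = l'.1) : l = l' ∨ l = litNeg l' := by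
  obtain ⟨v, s⟩ := l
  obtain ⟨v', s'⟩ := l'
  obtain rfl : v = v' := h
  cases s <;> cases s' <;> simp [litNeg]

/-- The probability of the sign of a literal. -/
def litWeight {n : ℕ} (p : ℝ) (l : Lit n) : ℝ := if l.2 = true then p else 1 - p

theorem litWeight_mul_litNeg {n : ℕ} (p : ℝ) (l : Lit n) :
    litWeight p l * litWeight p (litNeg l) = p * (1 - p) := by
  obtain ⟨v, s⟩ := l
  cases s <;> simp [litWeight, litNeg, mul_comm]

theorem litWeight_nonneg {n : ℕ} {p : ℝ} (hp0 : 0 ≤ p) (hp1 : p ≤ 1) (l : Lit n) :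
    0 ≤ litWeight p l := by
  unfold litWeight; split_ifs <;> linarith

theorem litWeight_le_one {n : ℕ} {p : ℝ} (hp0 : 0 ≤ p) (hp1 : p ≤ 1) (l : Lit n) :
    litWeight p l ≤ 1 := by
  unfold litWeight; split_ifs <;> linarith

/-- The set of literals of a clause. -/
def clauseLits {k n : ℕ} (C : KClause k n) : Finset (Lit n) :=
  Finset.univ.image fun x : C.1.1 => ((x.1, C.2 x) : Lit n)

theorem mem_clauseLits {k n : ℕ} {C : KClause k n} {l : Lit n} :
    l ∈ clauseLits C ↔ ∃ x : C.1.1, (x.1, C.2 x) = l := by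
  simp [clauseLits]

theorem satisfiedBy_iff {k n : ℕ} {C : KClause k n} {a : Fin n → Bool} :
    C.SatisfiedBy a ↔ ∃ l ∈ clauseLits C, a l.1 = l.2 := by
  constructor
  · rintro ⟨x, hx⟩
    exact ⟨(x.1, C.2 x), mem_clauseLits.2 ⟨x, rfl⟩, hx⟩
  · rintro ⟨l, hl, hx⟩
    obtain ⟨x, rfl⟩ := mem_clauseLits.1 hl
    exact ⟨x, hx⟩

theorem clauseProb_eq {k n : ℕ} (p : ℝ) (C : KClause k n) :
    clauseProb p C = ((n.choose k : ℝ))⁻¹ * ∏ l ∈ clauseLits C, litWeight p l := by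
  rw [clauseProb, clauseLits, Finset.prod_image]
  · rfl
  · intro x _ y _ h
    exact Subtype.ext (congrArg Prod.fst h)

theorem clauseProb_nonneg {k n : ℕ} {p : ℝ} (hp0 : 0 ≤ p) (hp1 : p ≤ 1) (C : KClause k n) :
    0 ≤ clauseProb p C := by
  rw [clauseProb_eq]
  exact mul_nonneg (by positivity) (Finset.prod_nonneg fun l _ => litWeight_nonneg hp0 hp1 l)

theorem clauseLits_image_fst {k n : ℕ} (C : KClause k n) :
    (clauseLits C).image Prod.fst = C.1.1 := by
  ext v
  simp [clauseLits]

theorem clauseLits_injective {k n : ℕ} :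
    Function.Injective (clauseLits : KClause k n → Finset (Lit n)) := by
  rintro ⟨⟨K, hK⟩, s⟩ ⟨⟨K', hK'⟩, s'⟩ h
  have h1 := congrArg (Finset.image Prod.fst) h
  rw [clauseLits_image_fst, clauseLits_image_fst] at h1
  obtain rfl : K = K' := h1
  congr 1
  funext x
  have h2 : ((x.1, s x) : Lit n) ∈ clauseLits (⟨⟨K, hK⟩, s⟩ : KClause k n) :=
    mem_clauseLits.2 ⟨x, rfl⟩
  rw [h] at h2
  obtain ⟨y, hy⟩ := mem_clauseLits.1 h2
  have h3 : y = x := Subtype.ext (congrArg Prod.fst hy)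
  have h4 := congrArg Prod.snd hy
  rw [h3] at h4
  exact h4.symm

theorem exists_clauseLits_eq_pair {n : ℕ} (C : KClause 2 n) :
    ∃ l l' : Lit n, l.1 ≠ l'.1 ∧ clauseLits C = {l, l'} := by
  obtain ⟨⟨K, hK⟩, s⟩ := C
  obtain ⟨x, y, hxy, rfl⟩ := Finset.card_eq_two.1 hK
  refine ⟨(x, s ⟨x, by simp⟩), (y, s ⟨y, by simp⟩), hxy, ?_⟩
  ext l
  rw [mem_clauseLits]
  constructor
  · rintro ⟨⟨z, hz⟩, rfl⟩
    rcases Finset.mem_insert.1 hz with rfl | hz'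
    · simp
    · obtain rfl := Finset.mem_singleton.1 hz'
      simp
  · intro hl
    rcases Finset.mem_insert.1 hl with rfl | hl'
    · exact ⟨⟨x, by simp⟩, rfl⟩
    · obtain rfl := Finset.mem_singleton.1 hl'
      exact ⟨⟨y, by simp⟩, rfl⟩

theorem exists_clause_of_pair {n : ℕ} {l l' : Lit n} (h : l.1 ≠ l'.1) :
    ∃ C : KClause 2 n, clauseLits C = {l, l'} := by
  refine ⟨⟨⟨{l.1, l'.1}, Finset.card_pair h⟩, fun x => if x.1 = l.1 then l.2 else l'.2⟩, ?_⟩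
  ext z
  rw [mem_clauseLits]
  constructor
  · rintro ⟨⟨z, hz⟩, rfl⟩
    rcases Finset.mem_insert.1 hz with rfl | hz'
    · simp
    · obtain rfl := Finset.mem_singleton.1 hz'
      simp [h.symm]
  · intro hl
    rcases Finset.mem_insert.1 hl with rfl | hl'
    · exact ⟨⟨z.1, by simp⟩, by simp⟩
    · obtain rfl := Finset.mem_singleton.1 hl'
      exact ⟨⟨z.1, by simp⟩, by simp [h.symm]⟩

theorem fst_ne_of_clauseLits_eq {n : ℕ} {C : KClause 2 n} {l l' : Lit n}
    (h : clauseLits C = {l, l'}) : l.1 ≠ l'.1 := by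
  intro hl
  have h1 := C.1.2
  rw [← clauseLits_image_fst, h] at h1
  simp [hl] at h1

/-- The probability that a random clause has the given set of literals. -/
noncomputable def pairProb {n : ℕ} (p : ℝ) (l l' : Lit n) : ℝ :=
  fiberWeight (clauseProb (k := 2) p) clauseLits {l, l'}

theorem pairProb_of_ne {n : ℕ} (p : ℝ) {l l' : Lit n} (h : l.1 ≠ l'.1) :
    pairProb p l l' = ((n.choose 2 : ℝ))⁻¹ * (litWeight p l * litWeight p l') := by
  obtain ⟨C, hC⟩ := exists_clause_of_pair h
  rw [pairProb, fiberWeight, Finset.sum_eq_single C, if_pos hC, mul_one, clauseProb_eq, hC,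
    Finset.prod_pair fun hl => h (congrArg Prod.fst hl)]
  · intro C' _ hC'
    rw [if_neg fun h' => hC' (clauseLits_injective (h'.trans hC.symm)), mul_zero]
  · simp

theorem pairProb_le {n : ℕ} {p : ℝ} (hp0 : 0 ≤ p) (hp1 : p ≤ 1) (l l' : Lit n) :
    pairProb p l l' ≤ ((n.choose 2 : ℝ))⁻¹ * (litWeight p l * litWeight p l') := by
  by_cases h : l.1 = l'.1
  · have h0 : pairProb p l l' = 0 := by
      refine Finset.sum_eq_zero fun C _ => ?_
      rw [if_neg fun h' => fst_ne_of_clauseLits_eq h' h, mul_zero]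
    rw [h0]
    have := litWeight_nonneg hp0 hp1 l
    have := litWeight_nonneg hp0 hp1 l'
    positivity
  · exact (pairProb_of_ne p h).le

/-! ### The implication digraph of a formula -/

/-- The formula `F` contains the clause `¬ l ∨ l'`. -/
def Implies {n m : ℕ} (F : Fin m → KClause 2 n) (l l' : Lit n) : Prop :=
  ∃ j, clauseLits (F j) = {litNeg l, l'}

theorem Implies.contrapose {n m : ℕ} {F : Fin m → KClause 2 n} {l l' : Lit n}
    (h : Implies F l l') : Implies F (litNeg l') (litNeg l) := by
  obtain ⟨j, hj⟩ := h
  exact ⟨j, by rw [hj, litNeg_litNeg, Finset.pair_comm]⟩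

theorem Implies.true_of_true {n m : ℕ} {F : Fin m → KClause 2 n} {l l' : Lit n}
    (h : Implies F l l') {a : Fin n → Bool} (ha : ∀ j, (F j).SatisfiedBy a)
    (hl : a l.1 = l.2) : a l'.1 = l'.2 := by
  obtain ⟨j, hj⟩ := h
  obtain ⟨z, hz, hza⟩ := satisfiedBy_iff.1 (ha j)
  rw [hj] at hz
  rcases Finset.mem_insert.1 hz with rfl | hz'
  · exfalso
    have : l.2 = !l.2 := hl.symm.trans hza
    simp at this
  · obtain rfl := Finset.mem_singleton.1 hz'
    exact hza

open Relation

/-- Reachability in the implication digraph. -/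
abbrev Reaches {n m : ℕ} (F : Fin m → KClause 2 n) : Lit n → Lit n → Prop :=
  ReflTransGen (Implies F)

theorem Reaches.contrapose {n m : ℕ} {F : Fin m → KClause 2 n} {l l' : Lit n}
    (h : Reaches F l l') : Reaches F (litNeg l') (litNeg l) := by
  induction h with
  | refl => exact ReflTransGen.refl
  | tail _ h ih => exact ReflTransGen.head h.contrapose ih

theorem Reaches.true_of_true {n m : ℕ} {F : Fin m → KClause 2 n} {l l' : Lit n}
    (h : Reaches F l l') {a : Fin n → Bool} (ha : ∀ j, (F j).SatisfiedBy a)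
    (hl : a l.1 = l.2) : a l'.1 = l'.2 := by
  induction h with
  | refl => exact hl
  | tail _ h ih => exact h.true_of_true ha ih

theorem not_satisfiable_of_reaches {n m : ℕ} {F : Fin m → KClause 2 n} {l : Lit n}
    (h : Reaches F l (litNeg l)) (h' : Reaches F (litNeg l) l) : ¬ FormulaSatisfiable F := by
  rintro ⟨a, ha⟩
  have key : ∀ l : Lit n, Reaches F l (litNeg l) → a l.1 ≠ l.2 := by
    intro l h hl
    have h1 : a l.1 = !l.2 := h.true_of_true ha hl
    rw [hl] at h1
    simp at h1
  have h1 := key l h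
  have h2 := key (litNeg l) (by rwa [litNeg_litNeg])
  simp only [litNeg] at h2
  cases h3 : a l.1 <;> cases h4 : l.2 <;> simp_all

/-- The 2-SAT theorem: a formula is satisfiable if no literal is equivalent to its negation. -/
theorem satisfiable_of_forall_not_reaches {n m : ℕ} {F : Fin m → KClause 2 n}
    (h : ∀ l, ¬ (Reaches F l (litNeg l) ∧ Reaches F (litNeg l) l)) : FormulaSatisfiable F := by
  classical
  let Good : Finset (Lit n) → Prop := fun T =>
    (∀ l ∈ T, litNeg l ∉ T) ∧ ∀ l ∈ T, ∀ l', Reaches F l l' → l' ∈ T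
  -- T is a largest consistent set of literals closed under implication, that is, a maximal partial
  -- assignment.
  obtain ⟨T, hT, hmax⟩ := (Finset.univ.filter Good).exists_max_image Finset.card
    ⟨∅, by simp [Good]⟩
  obtain ⟨hcons, hclosed⟩ := (Finset.mem_filter.1 hT).2
  have hfull : ∀ l : Lit n, l ∈ T ∨ litNeg l ∈ T := by
    by_contra! hne
    obtain ⟨l₀, hl₀, hl₀'⟩ := hne
    -- One of the two literals of an undecided variable does not reach its negation; making it true,
    -- with everything it reaches, enlarges T.
    obtain ⟨l, hl, hl', hr⟩ : ∃ l, l ∉ T ∧ litNeg l ∉ T ∧ ¬ Reaches F l (litNeg l) := by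
      by_cases h1 : Reaches F l₀ (litNeg l₀)
      · refine ⟨litNeg l₀, hl₀', by rwa [litNeg_litNeg], ?_⟩
        rw [litNeg_litNeg]
        exact fun h2 => h l₀ ⟨h1, h2⟩
      · exact ⟨l₀, hl₀, hl₀', h1⟩
    -- If ¬z were in T, the contrapositive ¬z → ¬l of l → z would force ¬l into T.
    have hcross : ∀ z, Reaches F l z → litNeg z ∉ T := by
      intro z hz hzT
      exact hl' (hclosed _ hzT _ hz.contrapose)
    have hG : Good (T ∪ Finset.univ.filter (Reaches F l)) := by
      constructor
      · intro z hz hz'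
        simp only [Finset.mem_union, Finset.mem_filter, Finset.mem_univ, true_and] at hz hz'
        rcases hz with hz | hz <;> rcases hz' with hz' | hz'
        · exact hcons z hz hz'
        · exact hcross _ hz' (by rwa [litNeg_litNeg])
        · exact hcross z hz hz'
        · have h1 := hz'.contrapose
          rw [litNeg_litNeg] at h1
          exact hr (hz.trans h1)
      · intro z hz z' hzz'
        simp only [Finset.mem_union, Finset.mem_filter, Finset.mem_univ, true_and] at hz ⊢
        rcases hz with hz | hz
        · exact Or.inl (hclosed z hz z' hzz')
        · exact Or.inr (hz.trans hzz')
    have h1 := hmax _ (Finset.mem_filter.2 ⟨Finset.mem_univ _, hG⟩)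
    have h2 : T ⊂ T ∪ Finset.univ.filter (Reaches F l) := by
      refine Finset.ssubset_iff_subset_ne.2 ⟨Finset.subset_union_left, fun h2 => hl ?_⟩
      rw [h2]
      exact Finset.mem_union_right _ (Finset.mem_filter.2 ⟨Finset.mem_univ _, ReflTransGen.refl⟩)
    exact absurd (Finset.card_lt_card h2) (not_lt.2 h1)
  refine ⟨fun v => decide ((v, true) ∈ T), fun j => ?_⟩
  have htrue : ∀ l ∈ T, decide (((l.1, true) : Lit n) ∈ T) = l.2 := by
    rintro ⟨v, s⟩ hl
    cases s
    · have := hcons _ hl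
      simpa [litNeg] using this
    · simpa using hl
  obtain ⟨l, l', -, hC⟩ := exists_clauseLits_eq_pair (F j)
  rw [satisfiedBy_iff]
  rcases hfull l with hl | hl
  · exact ⟨l, by simp [hC], htrue l hl⟩
  · refine ⟨l', by simp [hC], htrue l' (hclosed _ hl _ (ReflTransGen.single ⟨j, ?_⟩))⟩
    rw [hC, litNeg_litNeg]

/-! ### Unsatisfiable formulas contain a sparse pattern -/

open Relation

theorem Reaches.exists_walk {n m : ℕ} {F : Fin m → KClause 2 n} {l l' : Lit n}
    (h : Reaches F l l') :
    ∃ (k : ℕ) (c : ℕ → Lit n), c 0 = l ∧ c k = l' ∧ ∀ i < k, Implies F (c i) (c (i + 1)) := by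
  induction h using ReflTransGen.head_induction_on with
  | refl => exact ⟨0, fun _ => l', rfl, rfl, by simp⟩
  | @head x y h _ ih =>
    obtain ⟨k, c, h0, hk, hc⟩ := ih
    refine ⟨k + 1, fun i => Nat.casesOn i x c, rfl, hk, ?_⟩
    intro i hi
    cases i with
    | zero => simpa [h0] using h
    | succ i => exact hc i (by omega)

theorem reaches_of_walk {n m : ℕ} {F : Fin m → KClause 2 n} {c : ℕ → Lit n} {k : ℕ}
    (hc : ∀ i < k, Implies F (c i) (c (i + 1))) {i j : ℕ} (hij : i ≤ j) (hj : j ≤ k) :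
    Reaches F (c i) (c j) := by
  induction j, hij using Nat.le_induction with
  | base => exact ReflTransGen.refl
  | succ j _ ih => exact (ih (by omega)).tail (hc j (by omega))

/-- An unsatisfiable formula contains a walk `c 0 → ⋯ → c (s + 1)` in its implication digraph with
`c a = ¬ c 0`, whose variables are otherwise distinct except that the last one is a repetition. -/
theorem exists_walk_of_not_satisfiable {n m : ℕ} {F : Fin m → KClause 2 n}
    (hF : ¬ FormulaSatisfiable F) :
    ∃ (s a : ℕ) (c : ℕ → Lit n), 1 ≤ a ∧ a ≤ s ∧ c a = litNeg (c 0) ∧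
      (∀ i ≤ s, Implies F (c i) (c (i + 1))) ∧
      (∀ i j, i < j → j ≤ s → i ≠ a → j ≠ a → (c i).1 ≠ (c j).1) ∧
      ∃ j ≤ s, (c (s + 1)).1 = (c j).1 := by
  classical
  let Bad : Lit n → Prop := fun l => Reaches F l (litNeg l) ∧ Reaches F (litNeg l) l
  -- Among all literals equivalent to their negation, the path to the negation is chosen shortest;
  -- minimality forces distinct variables.
  have hP : ∃ a, ∃ c : ℕ → Lit n, Bad (c 0) ∧ c a = litNeg (c 0) ∧
      ∀ i < a, Implies F (c i) (c (i + 1)) := by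
    by_contra! hne
    refine hF (satisfiable_of_forall_not_reaches fun l hl => ?_)
    obtain ⟨k, c, h0, hk, hc⟩ := hl.1.exists_walk
    obtain ⟨i, hi, hi'⟩ := hne k c (by rw [h0]; exact hl) (by rw [h0, hk])
    exact hi' (hc i hi)
  obtain ⟨c, hbad, hca, hc⟩ := Nat.find_spec hP
  set a := Nat.find hP with ha
  have hmin : ∀ a' < a, ∀ c : ℕ → Lit n, Bad (c 0) → c a' = litNeg (c 0) →
      (∀ i < a', Implies F (c i) (c (i + 1))) → False := fun a' ha' c h1 h2 h3 =>
    Nat.find_min hP ha' ⟨c, h1, h2, h3⟩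
  have ha1 : 1 ≤ a := by
    rcases Nat.eq_zero_or_pos a with h | h
    · rw [h] at hca
      exact absurd hca.symm (litNeg_ne _)
    · exact h
  -- A repeated literal allows the loop between its two visits to be cut out. If instead c j = ¬ c
  -- i, the segment from i to j is a shorter path of the same kind, as c i lies on a closed walk
  -- through c 0 and c a and so is equivalent to its negation.
  have hdist : ∀ i j, i < j → j < a → (c i).1 ≠ (c j).1 := by
    intro i j hij hja heq
    rcases eq_or_eq_litNeg heq with h | h
    · refine hmin (a - (j - i)) (by omega) (fun k => if k ≤ i then c k else c (k + (j - i)))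
        (by simpa using hbad) ?_ ?_
      · simp only [Nat.zero_le, if_true]
        rw [if_neg (by omega), ← hca]
        congr 1
        omega
      · intro k hk
        rcases lt_trichotomy k i with h' | h' | h'
        · rw [if_pos (by omega), if_pos (by omega)]
          exact hc k (by omega)
        · subst h'
          rw [if_pos le_rfl, if_neg (by omega), h, show k + 1 + (j - k) = j + 1 by omega]
          exact hc j (by omega)
        · rw [if_neg (by omega), if_neg (by omega), show k + 1 + (j - i) = k + (j - i) + 1 by omega]
          exact hc _ (by omega)
    · have h' : c j = litNeg (c i) := by rw [h, litNeg_litNeg]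
      refine hmin (j - i) (by omega) (fun k => c (i + k)) ⟨?_, ?_⟩ ?_ ?_
      · rw [add_zero, ← h']
        exact reaches_of_walk hc hij.le hja.le
      · rw [add_zero, ← h']
        have h1 := reaches_of_walk hc hja.le le_rfl
        rw [hca] at h1
        exact (h1.trans hbad.2).trans (reaches_of_walk hc (Nat.zero_le i) (hij.le.trans hja.le))
      · rw [add_zero, ← h', show i + (j - i) = j by omega]
      · intro k hk
        exact hc (i + k) (by omega)
  obtain ⟨b, d, hd0, hdb, hd⟩ := hbad.2.exists_walk
  have hb : b ≠ 0 := by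
    rintro rfl
    exact litNeg_ne _ (hd0.symm.trans hdb)
  set e : ℕ → Lit n := fun i => if i ≤ a then c i else d (i - a) with he
  have he1 : ∀ i ≤ a, e i = c i := fun i hi => if_pos hi
  have he2 : ∀ i, a ≤ i → e i = d (i - a) := by
    intro i hi
    rcases hi.eq_or_lt with h | h
    · rw [← h, he1 a le_rfl, Nat.sub_self, hd0, hca]
    · exact if_neg (by omega)
  have hstep : ∀ i < a + b, Implies F (e i) (e (i + 1)) := by
    intro i hi
    rcases lt_or_ge i a with h | h
    · rw [he1 i h.le, he1 (i + 1) h]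
      exact hc i h
    · rw [he2 i h, he2 (i + 1) (by omega), show i + 1 - a = i - a + 1 by omega]
      exact hd _ (by omega)
  -- The walk continues along the path back to c 0 and is stopped at the first time after a at which
  -- a variable recurs; the return to c 0 itself ensures that there is one.
  have hQ : ∃ t, a < t ∧ ∃ j < t, (e t).1 = (e j).1 := by
    refine ⟨a + b, by omega, 0, by omega, ?_⟩
    rw [he1 0 (Nat.zero_le _), he2 _ (by omega), Nat.add_sub_cancel_left, hdb]
  obtain ⟨hat, j, hjt, hj⟩ := Nat.find_spec hQ
  have htb : Nat.find hQ ≤ a + b := by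
    refine Nat.find_min' hQ ⟨by omega, 0, by omega, ?_⟩
    rw [he1 0 (Nat.zero_le _), he2 _ (by omega), Nat.add_sub_cancel_left, hdb]
  have hmint : ∀ t < Nat.find hQ, a < t → ∀ j < t, (e t).1 ≠ (e j).1 := by
    intro t ht hat j hjt h
    exact Nat.find_min hQ ht ⟨hat, j, hjt, h⟩
  obtain ⟨s, hs⟩ : ∃ s, Nat.find hQ = s + 1 := ⟨Nat.find hQ - 1, by omega⟩
  rw [hs] at hat hjt hj htb hmint
  refine ⟨s, a, e, ha1, by omega, ?_, fun i hi => hstep i (by omega), ?_, j, by omega, hj⟩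
  · rw [he1 a le_rfl, he1 0 (Nat.zero_le _), hca]
  · intro i j hij hjs hia hja
    rcases lt_or_gt_of_ne hja with h | h
    · rw [he1 i (by omega), he1 j h.le]
      exact hdist i j hij h
    · exact (hmint j (by omega) h i hij).symm

/-- The end of the `i`-th step of the walk `g 0 → ⋯ → g s → z`. -/
def walkNext {n s : ℕ} (g : Fin (s + 1) → Lit n) (z : Lit n) (i : Fin (s + 1)) : Lit n :=
  (Fin.snoc g z : Fin (s + 2) → Lit n) i.succ

/-- The first moment needs distinct clauses. Since the only coincidence of variables among c 0, …, c
s is c a = ¬ c 0, no two steps of the walk can use the same clause. The end of the last step is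
encoded by the index j of the variable it repeats and a sign b. -/
theorem exists_pattern_of_not_satisfiable {n m : ℕ} {F : Fin m → KClause 2 n}
    (hF : ¬ FormulaSatisfiable F) :
    ∃ s ∈ Finset.Icc 1 n, ∃ (a j : Fin (s + 1)) (b : Bool) (g : Fin (s + 1) → Lit n),
      a ≠ 0 ∧ g a = litNeg (g 0) ∧ ∃ σ : Fin (s + 1) → Fin m, σ.Injective ∧
        ∀ i, clauseLits (F (σ i)) = {litNeg (g i), walkNext g ((g j).1, b) i} := by
  obtain ⟨s, a, c, ha1, has, hca, hstep, hdist, j, hjs, hj⟩ := exists_walk_of_not_satisfiable hF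
  have hvar : ∀ i j, i < j → j ≤ s → (c i).1 = (c j).1 → i = 0 ∧ j = a := by
    intro i j hij hjs h
    by_cases hja : j = a
    · refine ⟨?_, hja⟩
      by_contra hi
      refine hdist 0 i (by omega) (by omega) (by omega) (by omega) ?_
      rw [h, hja, hca, litNeg_fst]
    · by_cases hia : i = a
      · exfalso
        refine hdist 0 j (by omega) (by omega) (by omega) hja ?_
        rw [← h, hia, hca, litNeg_fst]
      · exact absurd h (hdist i j hij hjs hia hja)
  have hsn : s ≤ n := by
    have h1 : Function.Injective fun i : Fin s => (c (i + 1)).1 := by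
      intro i i' h
      by_contra hne
      rcases lt_or_gt_of_ne hne with h' | h'
      · have := hvar (i + 1) (i' + 1) (by simpa using h') (by omega) h
        omega
      · have := hvar (i' + 1) (i + 1) (by simpa using h') (by omega) h.symm
        omega
    simpa using Fintype.card_le_of_injective _ h1
  have hnext : ∀ i : Fin (s + 1),
      walkNext (fun i : Fin (s + 1) => c i) ((c j).1, (c (s + 1)).2) i = c (i + 1) := by
    intro i
    unfold walkNext
    induction i using Fin.lastCases with
    | last => rw [Fin.succ_last, Fin.snoc_last, ← hj]; rfl
    | cast i => rw [Fin.succ_castSucc, Fin.snoc_castSucc]; simp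
  choose σ hσ using fun i : Fin (s + 1) => hstep i (by omega)
  refine ⟨s, Finset.mem_Icc.2 ⟨by omega, hsn⟩, ⟨a, by omega⟩, ⟨j, by omega⟩, (c (s + 1)).2,
    fun i => c i, ?_, by simpa using hca, σ, ?_, fun i => by rw [hσ i, hnext i]⟩
  · intro h
    have := congrArg Fin.val h
    simp at this
    omega
  -- A common clause makes ¬ c i' equal to ¬ c i or to c (i + 1). The first is possible only for i =
  -- 0, i' = a, where the signs differ; the second repeats a variable or, when i' = i + 1, equates a
  -- literal with its negation.
  · have key : ∀ i i' : Fin (s + 1), i < i' → σ i ≠ σ i' := by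
      intro i i' hii h
      have hlt : (i : ℕ) < i' := hii
      have h1 := hσ i
      rw [h, hσ i'] at h1
      have h2 : litNeg (c i') = litNeg (c i) ∨ litNeg (c i') = c (i + 1) := by
        have : litNeg (c i') ∈ ({litNeg (c i), c (i + 1)} : Finset (Lit n)) := by
          rw [← h1]; simp
        simpa using this
      rcases h2 with h2 | h2
      · have h3 := litNeg_injective h2
        obtain ⟨h4, h5⟩ := hvar i i' hlt (by omega) (by rw [h3])
        rw [h4, h5, hca] at h3
        exact litNeg_ne _ h3
      · rcases (show (i : ℕ) + 1 ≤ i' from hlt).eq_or_lt with h3 | h3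
        · rw [h3] at h2
          exact litNeg_ne _ h2
        · have := hvar (i + 1) i' h3 (by omega) (by rw [← h2, litNeg_fst])
          omega
    intro i i' h
    by_contra hne
    rcases lt_or_gt_of_ne hne with h' | h'
    · exact key i i' h' h
    · exact key i' i h' h.symm

/-! ### The first moment bound -/

theorem sum_filter_le_sum_of_exists {S T : Type*} [Fintype S] {W : S → ℝ} (hW : ∀ F, 0 ≤ W F)
    (I : Finset T) (A : T → S → Prop) (B : S → Prop) [∀ t, DecidablePred (A t)] [DecidablePred B]
    (h : ∀ F, B F → ∃ t ∈ I, A t F) : ∑ F with B F, W F ≤ ∑ t ∈ I, ∑ F with A t F, W F := by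
  simp only [Finset.sum_filter]
  rw [Finset.sum_comm]
  refine Finset.sum_le_sum fun F _ => ?_
  have h0 : ∀ t ∈ I, 0 ≤ if A t F then W F else 0 := fun t _ => by
    split_ifs
    exacts [hW F, le_rfl]
  split_ifs with hB
  · obtain ⟨t, ht, hA⟩ := h F hB
    have := Finset.single_le_sum h0 ht
    rwa [if_pos hA] at this
  · exact Finset.sum_nonneg h0

/-- Each of g 1, …, g s is the head of one step and the tail of the next and contributes r = p(1 -
p); the weights left over at the two ends are at most 1. -/
theorem prod_walk_le {n s : ℕ} {p : ℝ} (hp0 : 0 ≤ p) (hp1 : p ≤ 1) (g : Fin (s + 1) → Lit n)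
    (z : Lit n) : ∏ i, (litWeight p (litNeg (g i)) * litWeight p (walkNext g z i)) ≤
      (p * (1 - p)) ^ s := by
  have h0 := litWeight_nonneg (n := n) hp0 hp1
  have h1 := litWeight_le_one (n := n) hp0 hp1
  rw [Finset.prod_mul_distrib, Fin.prod_univ_succ,
    Fin.prod_univ_castSucc fun i => litWeight p (walkNext g z i)]
  have h2 : ∀ i : Fin s, walkNext g z i.castSucc = g i.succ := fun i => by
    rw [walkNext, Fin.succ_castSucc, Fin.snoc_castSucc]
  simp only [h2]
  have h3 : (∏ i : Fin s, litWeight p (litNeg (g i.succ))) * ∏ i : Fin s, litWeight p (g i.succ) =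
      (p * (1 - p)) ^ s := by
    rw [← Finset.prod_mul_distrib]
    simp [mul_comm (litWeight p (litNeg _)), litWeight_mul_litNeg]
  have h4 : 0 ≤ (p * (1 - p)) ^ s := pow_nonneg (mul_nonneg hp0 (by linarith)) s
  calc _ = (p * (1 - p)) ^ s *
        (litWeight p (litNeg (g 0)) * litWeight p (walkNext g z (Fin.last s))) := by
        rw [← h3]; ring
    _ ≤ _ := mul_le_of_le_one_right h4 (mul_le_one₀ (h1 _) (h0 _) (h1 _))

/-- The entry at a is determined by the entry at 0, which leaves s free literals for s + 1 clauses.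
-/
theorem card_filter_eq_litNeg_le {n s : ℕ} (a : Fin (s + 1)) (ha : a ≠ 0) :
    (Finset.univ.filter fun g : Fin (s + 1) → Lit n => g a = litNeg (g 0)).card ≤
      (2 * n) ^ s := by
  have h1 : (Finset.univ : Finset (Fin s → Lit n)).card = (2 * n) ^ s := by
    simp [mul_comm]
  rw [← h1]
  refine Finset.card_le_card_of_injOn (fun g i => g (a.succAbove i)) (by simp) ?_
  intro g hg g' hg' h
  simp only [Finset.coe_filter, Finset.mem_univ, true_and, Set.mem_ofPred_eq] at hg hg'
  have h2 : ∀ i, i ≠ a → g i = g' i := by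
    intro i hi
    obtain ⟨k, rfl⟩ := Fin.exists_succAbove_eq hi
    exact congrFun h k
  funext i
  by_cases hi : i = a
  · rw [hi, hg, hg', h2 0 ha.symm]
  · exact h2 i hi

theorem satProb_add_eq_one {k n : ℕ} (hkn : k ≤ n) (m : ℕ) (p : ℝ)
    [DecidablePred fun F : Fin m → KClause k n => ¬ FormulaSatisfiable F] :
    satProb k n m p + ∑ F : Fin m → KClause k n with ¬ FormulaSatisfiable F,
      ∏ j, clauseProb p (F j) = 1 := by
  classical
  rw [satProb, ← sum_prod_eq_one (m := m) (sum_clauseProb hkn p)]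
  convert Finset.sum_filter_add_sum_filter_not Finset.univ
    (fun F : Fin m → KClause k n => FormulaSatisfiable F) _

/-- The first moment bound on the probability of unsatisfiability. -/
theorem one_sub_satProb_le {n : ℕ} (hn : 2 ≤ n) (m : ℕ) {p : ℝ} (hp0 : 0 ≤ p) (hp1 : p ≤ 1) :
    1 - satProb 2 n m p ≤ (m / (n.choose 2 : ℝ)) * ∑ s ∈ Finset.Icc 1 n,
      2 * ((s : ℝ) + 1) ^ 2 * (2 * n * (p * (1 - p)) * (m / (n.choose 2 : ℝ))) ^ s := by
  classical
  have hq := clauseProb_nonneg (k := 2) (n := n) hp0 hp1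
  have hq1 := sum_clauseProb hn p
  have hr : 0 ≤ p * (1 - p) := mul_nonneg hp0 (by linarith)
  set c : ℝ := m / (n.choose 2 : ℝ) with hc
  have hc0 : 0 ≤ c := by positivity
  rw [← eq_sub_iff_add_eq'.2 (satProb_add_eq_one hn m p)]
  let T : ℕ → Type := fun s => Fin (s + 1) × Fin (s + 1) × Bool × (Fin (s + 1) → Lit n)
  let I : (s : ℕ) → Finset (T s) := fun s =>
    Finset.univ.filter fun t => t.1 ≠ 0 ∧ t.2.2.2 t.1 = litNeg (t.2.2.2 0)
  let e : (s : ℕ) → T s → Fin (s + 1) → Finset (Lit n) := fun s t i =>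
    {litNeg (t.2.2.2 i), walkNext t.2.2.2 ((t.2.2.2 t.2.1).1, t.2.2.1) i}
  have hW : ∀ F : Fin m → KClause 2 n, 0 ≤ ∏ j, clauseProb p (F j) :=
    fun F => Finset.prod_nonneg fun j _ => hq _
  have hterm : ∀ s, ∀ t : T s, (∑ F : Fin m → KClause 2 n with
      ∃ σ : Fin (s + 1) → Fin m, σ.Injective ∧ ∀ i, clauseLits (F (σ i)) = e s t i,
      ∏ j, clauseProb p (F j)) ≤ c ^ (s + 1) * (p * (1 - p)) ^ s := by
    intro s t
    calc _ ≤ ∏ i, (m * fiberWeight (clauseProb p) clauseLits (e s t i)) := by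
          convert first_moment_pattern (m := m) hq hq1 clauseLits (e s t)
      _ ≤ ∏ i, (c * (litWeight p (litNeg (t.2.2.2 i)) *
          litWeight p (walkNext t.2.2.2 ((t.2.2.2 t.2.1).1, t.2.2.1) i))) := by
          refine Finset.prod_le_prod (fun i _ => mul_nonneg (Nat.cast_nonneg _)
            (fiberWeight_nonneg hq _ _)) fun i _ => ?_
          refine (mul_le_mul_of_nonneg_left (pairProb_le hp0 hp1 _ _)
            (Nat.cast_nonneg m)).trans (le_of_eq ?_)
          rw [hc]; ring
      _ ≤ _ := by
          rw [Finset.prod_mul_distrib, Finset.prod_const, Finset.card_univ, Fintype.card_fin]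
          exact mul_le_mul_of_nonneg_left (prod_walk_le hp0 hp1 _ _) (by positivity)
  -- The factor 2(s + 1)² counts the choices of a, j and the sign b.
  have hcard : ∀ s, ((I s).card : ℝ) ≤ 2 * ((s : ℝ) + 1) ^ 2 * (2 * n) ^ s := by
    intro s
    have h1 : (I s).card ≤ ∑ _a : Fin (s + 1), ∑ _j : Fin (s + 1), ∑ _b : Bool, (2 * n) ^ s := by
      rw [Finset.card_filter, Fintype.sum_prod_type]
      refine Finset.sum_le_sum fun a _ => ?_
      rw [Fintype.sum_prod_type]
      refine Finset.sum_le_sum fun j _ => ?_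
      rw [Fintype.sum_prod_type]
      refine Finset.sum_le_sum fun b _ => ?_
      by_cases ha : a = 0
      · simp [ha]
      · simp only [ne_eq, ha, not_false_eq_true, true_and]
        rw [← Finset.card_filter]
        exact card_filter_eq_litNeg_le a ha
    have h2 : ((I s).card : ℝ) ≤
        ((∑ _a : Fin (s + 1), ∑ _j : Fin (s + 1), ∑ _b : Bool, (2 * n) ^ s : ℕ) : ℝ) := by
      exact_mod_cast h1
    refine h2.trans (le_of_eq ?_)
    simp
    ring
  calc _ ≤ ∑ t ∈ (Finset.Icc 1 n).sigma I, ∑ F : Fin m → KClause 2 n with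
        ∃ σ : Fin (t.1 + 1) → Fin m, σ.Injective ∧ ∀ i, clauseLits (F (σ i)) = e t.1 t.2 i,
        ∏ j, clauseProb p (F j) := by
        refine sum_filter_le_sum_of_exists hW _ _ _ fun F hF => ?_
        obtain ⟨s, hs, a, j, b, g, ha, hg, σ, hσ, h⟩ := exists_pattern_of_not_satisfiable hF
        exact ⟨⟨s, (a, j, b, g)⟩, Finset.mem_sigma.2 ⟨hs, Finset.mem_filter.2
          ⟨Finset.mem_univ _, ha, hg⟩⟩, σ, hσ, h⟩
    _ ≤ ∑ s ∈ Finset.Icc 1 n, ∑ t ∈ I s, c ^ (s + 1) * (p * (1 - p)) ^ s := by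
        rw [Finset.sum_sigma]
        exact Finset.sum_le_sum fun s _ => Finset.sum_le_sum fun t _ => hterm s t
    _ ≤ _ := by
        rw [Finset.mul_sum]
        refine Finset.sum_le_sum fun s _ => ?_
        rw [Finset.sum_const, nsmul_eq_mul]
        refine (mul_le_mul_of_nonneg_right (hcard s) (by positivity)).trans (le_of_eq ?_)
        rw [mul_pow (2 * (n : ℝ) * _), mul_pow (2 * (n : ℝ)), pow_succ]
        generalize (2 * (n : ℝ)) ^ s = A
        generalize (p * (1 - p)) ^ s = B
        ring

/-! ### Powers of a perturbed rank-one matrix -/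

section RankOne

variable {L : Type*} [Fintype L] [DecidableEq L]

theorem matrix_pow_nonneg {P : Matrix L L ℝ} (hP : ∀ x y, 0 ≤ P x y) (k : ℕ) (x y : L) :
    0 ≤ (P ^ k) x y := by
  induction k generalizing x with
  | zero =>
    rw [pow_zero, Matrix.one_apply]
    split_ifs <;> norm_num
  | succ k ih =>
    rw [pow_succ', Matrix.mul_apply]
    exact Finset.sum_nonneg fun z _ => mul_nonneg (hP x z) (ih z)

theorem matrix_pow_mulVec_le {P : Matrix L L ℝ} (hP : ∀ x y, 0 ≤ P x y) {h : L → ℝ} {θ : ℝ}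
    (hθ : 0 ≤ θ) (hPh : ∀ x, ∑ y, P x y * h y ≤ θ * h x) (k : ℕ) (x : L) :
    ∑ y, (P ^ k) x y * h y ≤ θ ^ k * h x := by
  induction k generalizing x with
  | zero => simp [Matrix.one_apply]
  | succ k ih =>
    calc ∑ y, (P ^ (k + 1)) x y * h y = ∑ z, P x z * ∑ y, (P ^ k) z y * h y := by
          simp only [pow_succ', Matrix.mul_apply, Finset.sum_mul, Finset.mul_sum, mul_assoc]
          exact Finset.sum_comm
      _ ≤ ∑ z, P x z * (θ ^ k * h z) :=
          Finset.sum_le_sum fun z _ => mul_le_mul_of_nonneg_left (ih z) (hP x z)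
      _ = θ ^ k * ∑ z, P x z * h z := by
          rw [Finset.mul_sum]; exact Finset.sum_congr rfl fun z _ => by ring
      _ ≤ θ ^ k * (θ * h x) := mul_le_mul_of_nonneg_left (hPh x) (pow_nonneg hθ k)
      _ = θ ^ (k + 1) * h x := by ring

/-- The exponent is k + 1 because v is compared with g only after one multiplication by P. -/
theorem matrix_vecMul_pow_le {P : Matrix L L ℝ} (hP : ∀ x y, 0 ≤ P x y) {v g : L → ℝ} {θ : ℝ}
    (hθ : 0 ≤ θ) (hvP : ∀ y, ∑ x, v x * P x y ≤ θ * g y) (hgP : ∀ y, ∑ x, g x * P x y ≤ θ * g y)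
    (k : ℕ) (y : L) : ∑ x, v x * (P ^ (k + 1)) x y ≤ θ ^ (k + 1) * g y := by
  induction k generalizing y with
  | zero => simpa using hvP y
  | succ k ih =>
    calc ∑ x, v x * (P ^ (k + 1 + 1)) x y = ∑ z, (∑ x, v x * (P ^ (k + 1)) x z) * P z y := by
          simp only [pow_succ _ (k + 1), Matrix.mul_apply, Finset.sum_mul, Finset.mul_sum,
            ← mul_assoc]
          exact Finset.sum_comm
      _ ≤ ∑ z, (θ ^ (k + 1) * g z) * P z y :=
          Finset.sum_le_sum fun z _ => mul_le_mul_of_nonneg_right (ih z) (hP z y)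
      _ = θ ^ (k + 1) * ∑ z, g z * P z y := by
          rw [Finset.mul_sum]; exact Finset.sum_congr rfl fun z _ => by ring
      _ ≤ θ ^ (k + 1) * (θ * g y) := mul_le_mul_of_nonneg_left (hgP y) (pow_nonneg hθ _)
      _ = θ ^ (k + 1 + 1) * g y := by ring

/-- The vector u + K h is a right sub-eigenvector of M for Γ: the rank-one part sends it to Γ u, and
P sends it to at most θ(1 + K) h ≤ K Γ h. The paths that never use the rank-one part are kept apart
as P^(k + 1). -/
theorem pow_rank_one_add_le {P M : Matrix L L ℝ} {u v h g : L → ℝ} {c θ K Γ : ℝ}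
    (hM : ∀ x y, M x y = c * (u x * v y) + P x y)
    (hP : ∀ x y, 0 ≤ P x y) (hu : ∀ x, 0 ≤ u x) (hv : ∀ x, 0 ≤ v x) (hh : ∀ x, 0 ≤ h x)
    (hg : ∀ x, 0 ≤ g x) (hc : 0 ≤ c) (hθ : 0 < θ) (hK : 0 ≤ K)
    (hPu : ∀ x, ∑ y, P x y * u y ≤ θ * h x) (hPh : ∀ x, ∑ y, P x y * h y ≤ θ * h x)
    (hvP : ∀ y, ∑ x, v x * P x y ≤ θ * g y) (hgP : ∀ y, ∑ x, g x * P x y ≤ θ * g y)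
    (hΓ : c * ∑ z, v z * (u z + K * h z) = Γ) (hΓθ : θ < Γ) (hKΓ : θ * (1 + K) ≤ K * Γ)
    (k : ℕ) (x y : L) :
    (M ^ (k + 1)) x y ≤
      (P ^ (k + 1)) x y + c * Γ ^ k * (u x + K * h x) * (v y + K * g y) := by
  have hΓ0 : 0 < Γ := hθ.trans hΓθ
  set ρ : ℝ := θ / Γ with hρ
  have hρ0 : 0 ≤ ρ := by positivity
  have hρΓ : ρ * Γ = θ := div_mul_cancel₀ _ hΓ0.ne'
  have hρK : ρ ≤ K * (1 - ρ) := by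
    refine le_of_mul_le_mul_right ?_ hΓ0
    calc ρ * Γ = θ := hρΓ
      _ ≤ K * Γ - K * θ := by linarith
      _ = K * (1 - ρ) * Γ := by rw [← hρΓ]; ring
  have hρ1 : ρ ≤ 1 := (div_le_one hΓ0).2 hΓθ.le
  have hU : ∀ x, 0 ≤ u x + K * h x := fun x => add_nonneg (hu x) (mul_nonneg hK (hh x))
  -- The left factor grows with k because each step adds u (v P^(k + 1)) ≤ θ^(k + 1) u g. The
  -- coefficient K(1 - ρ^k) absorbs this, as ρ ≤ K(1 - ρ) is the hypothesis θ(1 + K) ≤ K Γ.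
  have key : ∀ k x y, (M ^ (k + 1)) x y ≤ (P ^ (k + 1)) x y +
      c * Γ ^ k * (u x + K * h x) * (v y + K * (1 - ρ ^ k) * g y) := by
    intro k
    induction k with
    | zero =>
      intro x y
      simp only [zero_add, pow_one, hM, pow_zero, mul_one, sub_self, mul_zero, zero_mul, add_zero]
      have h1 : 0 ≤ c * (K * h x * v y) :=
        mul_nonneg hc (mul_nonneg (mul_nonneg hK (hh x)) (hv y))
      linarith
    | succ k ih =>
      intro x y
      set Y : ℝ := v y + K * (1 - ρ ^ k) * g y with hY
      have hρk : ρ ^ k ≤ 1 := pow_le_one₀ hρ0 hρ1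
      have hY0 : 0 ≤ Y := add_nonneg (hv y)
        (mul_nonneg (mul_nonneg hK (by linarith)) (hg y))
      have h1 : (M ^ (k + 1 + 1)) x y ≤
          ∑ z, (c * (u x * v z) + P x z) * ((P ^ (k + 1)) z y +
            c * Γ ^ k * (u z + K * h z) * Y) := by
        rw [pow_succ', Matrix.mul_apply]
        refine Finset.sum_le_sum fun z _ => ?_
        rw [hM]
        exact mul_le_mul_of_nonneg_left (ih z y) (add_nonneg (mul_nonneg hc
          (mul_nonneg (hu x) (hv z))) (hP x z))
      have h2 : ∑ z, (c * (u x * v z) + P x z) * ((P ^ (k + 1)) z y +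
            c * Γ ^ k * (u z + K * h z) * Y) =
          c * u x * (∑ z, v z * (P ^ (k + 1)) z y) + (P ^ (k + 1 + 1)) x y +
          c * Γ ^ k * Y * (u x * (c * ∑ z, v z * (u z + K * h z)) +
            (∑ z, P x z * u z + K * ∑ z, P x z * h z)) := by
        rw [pow_succ' P (k + 1), Matrix.mul_apply]
        simp only [Finset.mul_sum, ← Finset.sum_add_distrib]
        exact Finset.sum_congr rfl fun z _ => by ring
      have h3 := matrix_vecMul_pow_le hP hθ.le hvP hgP k y
      have h4 : u x * (c * ∑ z, v z * (u z + K * h z)) +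
            (∑ z, P x z * u z + K * ∑ z, P x z * h z) ≤ Γ * (u x + K * h x) := by
        rw [hΓ]
        have h5 := mul_le_mul_of_nonneg_left (hPh x) hK
        have h6 := mul_le_mul_of_nonneg_right hKΓ (hh x)
        linarith [hPu x]
      have h5 : c * u x * (∑ z, v z * (P ^ (k + 1)) z y) ≤
          c * Γ ^ (k + 1) * (u x + K * h x) * (ρ ^ (k + 1) * g y) := by
        have h6 : θ ^ (k + 1) * g y = Γ ^ (k + 1) * (ρ ^ (k + 1) * g y) := by
          rw [← hρΓ, mul_pow]; ring
        calc _ ≤ c * u x * (Γ ^ (k + 1) * (ρ ^ (k + 1) * g y)) := by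
              rw [← h6]
              exact mul_le_mul_of_nonneg_left h3 (mul_nonneg hc (hu x))
          _ ≤ c * (u x + K * h x) * (Γ ^ (k + 1) * (ρ ^ (k + 1) * g y)) := by
              refine mul_le_mul_of_nonneg_right (mul_le_mul_of_nonneg_left ?_ hc) ?_
              · exact le_add_of_nonneg_right (mul_nonneg hK (hh x))
              · exact mul_nonneg (pow_nonneg hΓ0.le _)
                  (mul_nonneg (pow_nonneg hρ0 _) (hg y))
          _ = _ := by ring
      have h6 : c * Γ ^ k * Y * (u x * (c * ∑ z, v z * (u z + K * h z)) +
            (∑ z, P x z * u z + K * ∑ z, P x z * h z)) ≤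
          c * Γ ^ (k + 1) * (u x + K * h x) * Y := by
        calc _ ≤ c * Γ ^ k * Y * (Γ * (u x + K * h x)) :=
              mul_le_mul_of_nonneg_left h4 (mul_nonneg (mul_nonneg hc (pow_nonneg hΓ0.le _)) hY0)
          _ = _ := by ring
      have h7 : ρ ^ (k + 1) * g y + Y ≤ v y + K * (1 - ρ ^ (k + 1)) * g y := by
        have h8 : ρ ^ k * ρ ≤ ρ ^ k * (K * (1 - ρ)) :=
          mul_le_mul_of_nonneg_left hρK (pow_nonneg hρ0 k)
        have h9 := mul_le_mul_of_nonneg_right h8 (hg y)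
        rw [hY, pow_succ]
        linarith
      have h8 := mul_le_mul_of_nonneg_left h7
        (mul_nonneg (mul_nonneg hc (pow_nonneg hΓ0.le (k + 1))) (hU x))
      rw [h2] at h1
      linarith
  refine (key k x y).trans (add_le_add_right ?_ _)
  refine mul_le_mul_of_nonneg_left ?_ (mul_nonneg (mul_nonneg hc (pow_nonneg hΓ0.le _)) (hU x))
  have h1 : 0 ≤ K * ρ ^ k * g y := mul_nonneg (mul_nonneg hK (pow_nonneg hρ0 k)) (hg y)
  linarith

end RankOne

/-! ### Sums over paths -/

/-- The path from `x` through `A` to `y`. -/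
def pathVertex {L : Type*} {k : ℕ} (x : L) (A : Fin k → L) (y : L) (i : ℕ) : L :=
  if i = 0 then x else if h : i - 1 < k then A ⟨i - 1, h⟩ else y

theorem pathVertex_zero {L : Type*} {k : ℕ} (x : L) (A : Fin k → L) (y : L) :
    pathVertex x A y 0 = x := rfl

theorem pathVertex_succ {L : Type*} {k : ℕ} (x : L) (A : Fin k → L) (y : L) (i : Fin k) :
    pathVertex x A y (i + 1) = A i := by
  simp [pathVertex]

theorem pathVertex_last {L : Type*} {k : ℕ} (x : L) (A : Fin k → L) (y : L) :
    pathVertex x A y (k + 1) = y := by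
  simp [pathVertex]

theorem pathVertex_cons_succ {L : Type*} {k : ℕ} (x z : L) (A : Fin k → L) (y : L) (i : ℕ) :
    pathVertex x (Fin.cons z A : Fin (k + 1) → L) y (i + 1) = pathVertex z A y i := by
  cases i with
  | zero => simp [pathVertex]
  | succ i =>
    by_cases h : i < k
    · have h2 := pathVertex_succ x (Fin.cons z A : Fin (k + 1) → L) y ⟨i + 1, by omega⟩
      have h3 := pathVertex_succ z A y ⟨i, h⟩
      dsimp only at h2 h3
      rw [h2, h3]
      exact Fin.cons_succ (α := fun _ => L) z A ⟨i, h⟩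
    · simp [pathVertex, h]

theorem sum_prod_pathVertex {L : Type*} [Fintype L] [DecidableEq L] (M : Matrix L L ℝ) (k : ℕ)
    (x y : L) : ∑ A : Fin k → L, ∏ i : Fin (k + 1),
      M (pathVertex x A y i) (pathVertex x A y (i + 1)) = (M ^ (k + 1)) x y := by
  induction k generalizing x with
  | zero =>
    simp [pathVertex]
  | succ k ih =>
    rw [pow_succ', Matrix.mul_apply, ← (Fin.consEquiv fun _ => L).sum_comp,
      Fintype.sum_prod_type]
    refine Finset.sum_congr rfl fun z _ => ?_
    rw [← ih z, Finset.mul_sum]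
    refine Finset.sum_congr rfl fun A _ => ?_
    have hcons : (Fin.consEquiv fun _ => L) (z, A) = (Fin.cons z A : Fin (k + 1) → L) := rfl
    rw [Fin.prod_univ_succ, hcons]
    simp only [Fin.val_zero, Fin.val_succ, pathVertex_cons_succ,
      pathVertex_zero]

/-! ### Contradictory cycles -/

/-- Two paths of length `t` from `x` to `¬ x` and back, on otherwise distinct variables. -/
structure IsSnake {n : ℕ} (t : ℕ) (c : Bool → ℕ → Lit n) : Prop where
  start : c true 0 = litNeg (c false 0)
  finish : ∀ b, c b t = litNeg (c b 0)
  inner : ∀ b b' i j, 0 < i → i < t → j ≤ t → (c b i).1 = (c b' j).1 → b = b' ∧ i = j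

/-- The four directed paths of a contradictory cycle in the implication digraph: the two paths
and their contrapositives. -/
def snakeSeg {n : ℕ} (t : ℕ) (c : Bool → ℕ → Lit n) (τ : Bool × Bool) (i : ℕ) : Lit n :=
  if τ.2 = true then litNeg (c τ.1 (t - i)) else c τ.1 i

/-- The number of occurrences of the implication `x → y` in a contradictory cycle. -/
def snakeMatrix {n : ℕ} (t : ℕ) (c : Bool → ℕ → Lit n) : Matrix (Lit n) (Lit n) ℝ := fun x y =>
  ∑ τ, ∑ i ∈ Finset.range t,
    if x = snakeSeg t c τ i ∧ y = snakeSeg t c τ (i + 1) then 1 else 0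

/-- A potential which grows slowly along the paths of a contradictory cycle. -/
noncomputable def snakePot {n : ℕ} (t : ℕ) (c : Bool → ℕ → Lit n) (x : Lit n) : ℝ :=
  ∑ τ, ∑ i ∈ Finset.range t, if x = snakeSeg t c τ i then 1 + (i : ℝ) / t else 0

section Snake

variable {n t : ℕ} {c : Bool → ℕ → Lit n}

theorem snakeSeg_fst_eq (τ : Bool × Bool) (i : ℕ) :
    (snakeSeg t c τ i).1 = (c τ.1 (if τ.2 = true then t - i else i)).1 := by
  unfold snakeSeg
  split_ifs <;> simp

theorem snakeSeg_contrapose (b r : Bool) {i : ℕ} (hi : i ≤ t) :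
    snakeSeg t c (b, !r) i = litNeg (snakeSeg t c (b, r) (t - i)) := by
  cases r
  · simp [snakeSeg]
  · simp [snakeSeg, Nat.sub_sub_self hi]

theorem IsSnake.seg_zero (hc : IsSnake t c) (b r : Bool) : snakeSeg t c (b, r) 0 = c b 0 := by
  cases r <;> simp [snakeSeg, hc.finish]

theorem IsSnake.apply_not (hc : IsSnake t c) (b : Bool) : c (!b) 0 = litNeg (c b 0) := by
  cases b <;> simp [hc.start]

theorem IsSnake.seg_last (hc : IsSnake t c) (b r : Bool) :
    snakeSeg t c (b, r) t = c (!b) 0 := by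
  cases r <;> simp [snakeSeg, hc.finish, hc.apply_not]

/-- Inner variables determine the path and the position on it; the sign then separates a path from
its contrapositive. -/
theorem IsSnake.seg_inj (hc : IsSnake t c) {τ τ' : Bool × Bool} {i j : ℕ} (hi : 0 < i)
    (hit : i < t) (hj : j < t) (h : snakeSeg t c τ i = snakeSeg t c τ' j) : τ = τ' ∧ i = j := by
  have h1 := congrArg Prod.fst h
  rw [snakeSeg_fst_eq, snakeSeg_fst_eq] at h1
  obtain ⟨h2, h3⟩ := hc.inner _ _ _ _ (by split_ifs <;> omega) (by split_ifs <;> omega)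
    (by split_ifs <;> omega) h1
  obtain ⟨b, r⟩ := τ
  obtain ⟨b', r'⟩ := τ'
  dsimp only at h2 h3
  subst h2
  cases r <;> cases r' <;> simp only [if_true, if_false, Bool.false_eq_true] at h3
  · exact ⟨rfl, h3⟩
  · simp only [snakeSeg, if_true, if_false, Bool.false_eq_true, ← h3] at h
    exact absurd h.symm (litNeg_ne _)
  · simp only [snakeSeg, if_true, if_false, Bool.false_eq_true, ← h3] at h
    exact absurd h (litNeg_ne _)
  · exact ⟨rfl, by omega⟩

theorem IsSnake.pot_inner (hc : IsSnake t c) (τ : Bool × Bool) {i : ℕ} (hi : 0 < i)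
    (hit : i < t) : snakePot t c (snakeSeg t c τ i) = 1 + (i : ℝ) / t := by
  rw [snakePot, Finset.sum_eq_single τ, Finset.sum_eq_single i, if_pos rfl]
  · intro j hj hji
    exact if_neg fun h => hji (hc.seg_inj hi hit (Finset.mem_range.1 hj) h).2.symm
  · intro h
    exact absurd (Finset.mem_range.2 hit) h
  · intro τ' _ hτ
    exact Finset.sum_eq_zero fun j hj =>
      if_neg fun h => hτ (hc.seg_inj hi hit (Finset.mem_range.1 hj) h).1.symm
  · simp

/-- Two of the four segments start at each end literal, each with value 1. The total 2 equals the
value 1 + t/t due at the end of an incoming segment, so the branching at the ends costs nothing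
beyond the growth along the segments. -/
theorem IsSnake.pot_zero (hc : IsSnake t c) (ht : 0 < t) (b : Bool) :
    snakePot t c (c b 0) = 2 := by
  have h1 : ∀ τ : Bool × Bool, (∑ j ∈ Finset.range t,
      if c b 0 = snakeSeg t c τ j then 1 + (j : ℝ) / t else 0) = if b = τ.1 then 1 else 0 := by
    rintro ⟨b', r⟩
    rw [Finset.sum_eq_single 0, hc.seg_zero]
    · by_cases hb : b = b'
      · simp [hb]
      · have hb' : b' = !b := by cases b <;> cases b' <;> simp_all
        have : c b 0 ≠ c b' 0 := by
          rw [hb', hc.apply_not]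
          exact (litNeg_ne _).symm
        rw [if_neg this, if_neg hb]
    · intro j hj hj0
      refine if_neg fun h => ?_
      rw [← hc.seg_zero b false] at h
      exact hj0 (hc.seg_inj (Nat.pos_of_ne_zero hj0) (Finset.mem_range.1 hj) ht h.symm).2
    · intro h
      exact absurd (Finset.mem_range.2 ht) h
  rw [snakePot]
  simp only [h1, Fintype.sum_prod_type]
  cases b <;> norm_num

theorem snakePot_nonneg (x : Lit n) : 0 ≤ snakePot t c x :=
  Finset.sum_nonneg fun τ _ => Finset.sum_nonneg fun i _ => by split_ifs <;> positivity

theorem IsSnake.pot_seg_le (hc : IsSnake t c) (ht : 0 < t) (τ : Bool × Bool) {i : ℕ}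
    (hi : i < t) : snakePot t c (snakeSeg t c τ i) ≤ 2 := by
  obtain ⟨b, r⟩ := τ
  rcases Nat.eq_zero_or_pos i with rfl | hi0
  · rw [hc.seg_zero, hc.pot_zero ht]
  · rw [hc.pot_inner _ hi0 hi]
    have : (i : ℝ) / t ≤ 1 := div_le_one_of_le₀ (by exact_mod_cast hi.le) (by positivity)
    linarith

theorem IsSnake.pot_le (hc : IsSnake t c) (ht : 0 < t) (x : Lit n) : snakePot t c x ≤ 2 := by
  by_cases h : snakePot t c x = 0
  · rw [h]; norm_num
  · obtain ⟨τ, -, h1⟩ := Finset.exists_ne_zero_of_sum_ne_zero h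
    obtain ⟨i, hi, h2⟩ := Finset.exists_ne_zero_of_sum_ne_zero h1
    have h3 : x = snakeSeg t c τ i := by
      by_contra hne
      exact h2 (if_neg hne)
    rw [h3]
    exact hc.pot_seg_le ht τ (Finset.mem_range.1 hi)

theorem IsSnake.pot_seg_succ_le (hc : IsSnake t c) (τ : Bool × Bool) {i : ℕ}
    (hi : i < t) : snakePot t c (snakeSeg t c τ (i + 1)) ≤ (1 + 1 / (t : ℝ)) * (1 + (i : ℝ) / t) := by
  have ht : 0 < t := by omega
  have ht' : (0 : ℝ) < t := by exact_mod_cast ht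
  have h1 : snakePot t c (snakeSeg t c τ (i + 1)) = 1 + ((i : ℝ) + 1) / t := by
    rcases (show i + 1 ≤ t from hi).eq_or_lt with h | h
    · obtain ⟨b, r⟩ := τ
      rw [h, hc.seg_last, hc.pot_zero ht]
      have : (i : ℝ) + 1 = t := by exact_mod_cast h
      rw [this, div_self ht'.ne']
      norm_num
    · rw [hc.pot_inner _ (Nat.succ_pos i) h]
      push_cast
      ring
  rw [h1, add_div]
  have : 0 ≤ (1 / (t : ℝ)) * ((i : ℝ) / t) := by positivity
  linarith

theorem snakeMatrix_nonneg (x y : Lit n) : 0 ≤ snakeMatrix t c x y :=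
  Finset.sum_nonneg fun τ _ => Finset.sum_nonneg fun i _ => by split_ifs <;> norm_num

/-- Used to turn the last factor of a power of P into h, after which P h ≤ θ h applies. -/
theorem snakeMatrix_le_pot (x y : Lit n) : snakeMatrix t c x y ≤ snakePot t c x := by
  refine Finset.sum_le_sum fun τ _ => Finset.sum_le_sum fun i _ => ?_
  have : (0 : ℝ) ≤ (i : ℝ) / t := by positivity
  split_ifs with h1 h2 h2
  · linarith
  · exact absurd h1.1 h2
  · linarith
  · exact le_rfl

theorem sum_snakeMatrix_mul (f : Lit n → ℝ) (x : Lit n) :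
    ∑ y, snakeMatrix t c x y * f y = ∑ τ, ∑ i ∈ Finset.range t,
      if x = snakeSeg t c τ i then f (snakeSeg t c τ (i + 1)) else 0 := by
  simp only [snakeMatrix, Finset.sum_mul]
  rw [Finset.sum_comm]
  refine Finset.sum_congr rfl fun τ _ => ?_
  rw [Finset.sum_comm]
  refine Finset.sum_congr rfl fun i _ => ?_
  by_cases h : x = snakeSeg t c τ i <;> simp [h]

theorem sum_snakeMatrix_mul_le_pot {f : Lit n → ℝ} (hf : ∀ x, f x ≤ 1) (x : Lit n) :
    ∑ y, snakeMatrix t c x y * f y ≤ snakePot t c x := by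
  rw [sum_snakeMatrix_mul]
  refine Finset.sum_le_sum fun τ _ => Finset.sum_le_sum fun i _ => ?_
  split_ifs
  · have : (0 : ℝ) ≤ (i : ℝ) / t := by positivity
    linarith [hf (snakeSeg t c τ (i + 1))]
  · exact le_rfl

theorem IsSnake.sum_matrix_mul_pot_le (hc : IsSnake t c) (x : Lit n) :
    ∑ y, snakeMatrix t c x y * snakePot t c y ≤ (1 + 1 / (t : ℝ)) * snakePot t c x := by
  rw [sum_snakeMatrix_mul, snakePot, Finset.mul_sum]
  refine Finset.sum_le_sum fun τ _ => ?_
  rw [Finset.mul_sum]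
  refine Finset.sum_le_sum fun i hi => ?_
  split_ifs
  · exact hc.pot_seg_succ_le τ (Finset.mem_range.1 hi)
  · simp

/-- Negation reverses the implications, so the row bounds on P also give column bounds. -/
theorem snakeMatrix_contrapose (x y : Lit n) :
    snakeMatrix t c (litNeg y) (litNeg x) = snakeMatrix t c x y := by
  unfold snakeMatrix
  have h1 : ∀ b r : Bool, (∑ i ∈ Finset.range t, if litNeg y = snakeSeg t c (b, r) i ∧
      litNeg x = snakeSeg t c (b, r) (i + 1) then (1 : ℝ) else 0) =
      ∑ i ∈ Finset.range t, if x = snakeSeg t c (b, !r) i ∧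
        y = snakeSeg t c (b, !r) (i + 1) then (1 : ℝ) else 0 := by
    intro b r
    rw [← Finset.sum_range_reflect]
    refine Finset.sum_congr rfl fun i hi => ?_
    have hi' := Finset.mem_range.1 hi
    rw [snakeSeg_contrapose b r hi'.le, snakeSeg_contrapose b r (show i + 1 ≤ t from hi'),
      show t - 1 - i + 1 = t - i by omega, show t - 1 - i = t - (i + 1) by omega]
    refine if_congr ?_ rfl rfl
    rw [litNeg_eq_iff, litNeg_eq_iff]
    exact and_comm
  rw [Fintype.sum_prod_type, Fintype.sum_prod_type]
  refine Finset.sum_congr rfl fun b _ => ?_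
  simp only [h1, Fintype.sum_bool, Bool.not_true, Bool.not_false]
  exact add_comm _ _

theorem sum_comp_litNeg (f : Lit n → ℝ) : ∑ x, f (litNeg x) = ∑ x, f x :=
  Equiv.sum_comp (Function.Involutive.toPerm litNeg litNeg_litNeg) f

theorem sum_mul_snakeMatrix (f : Lit n → ℝ) (y : Lit n) :
    ∑ x, f (litNeg x) * snakeMatrix t c x y = ∑ z, snakeMatrix t c (litNeg y) z * f z := by
  rw [← sum_comp_litNeg]
  refine Finset.sum_congr rfl fun x _ => ?_
  rw [litNeg_litNeg, ← snakeMatrix_contrapose, litNeg_litNeg, mul_comm]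

/-- Four segments, t positions on each, and values at most 2. -/
theorem sum_snakePot_le : ∑ x, snakePot t c x ≤ 8 * t := by
  unfold snakePot
  rw [Finset.sum_comm]
  have h1 : ∀ τ : Bool × Bool, (∑ x : Lit n, ∑ i ∈ Finset.range t,
      if x = snakeSeg t c τ i then 1 + (i : ℝ) / t else 0) ≤ 2 * t := by
    intro τ
    rw [Finset.sum_comm]
    calc _ ≤ ∑ i ∈ Finset.range t, (2 : ℝ) := by
          refine Finset.sum_le_sum fun i hi => ?_
          rw [Finset.sum_ite_eq' Finset.univ (snakeSeg t c τ i), if_pos (Finset.mem_univ _)]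
          have : (i : ℝ) / t ≤ 1 := div_le_one_of_le₀
            (by exact_mod_cast (Finset.mem_range.1 hi).le) (by positivity)
          linarith
      _ = _ := by simp [mul_comm]
  refine (Finset.sum_le_sum fun τ _ => h1 τ).trans (le_of_eq ?_)
  simp
  ring

/-- A clause of the snake can be read as an implication in two ways, along the path or along its
contrapositive. This is why P has to count all four segments. -/
theorem sum_edge_le_snakeMatrix (x y : Lit n) :
    (∑ ι : Bool × Fin t, if ({litNeg (c ι.1 ι.2), c ι.1 (ι.2 + 1)} : Finset (Lit n)) =
      {litNeg x, y} then (1 : ℝ) else 0) ≤ snakeMatrix t c x y := by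
  unfold snakeMatrix
  rw [Fintype.sum_prod_type, Fintype.sum_prod_type]
  refine Finset.sum_le_sum fun b _ => ?_
  have h1 : (∑ i ∈ Finset.range t, if x = snakeSeg t c (b, true) i ∧
      y = snakeSeg t c (b, true) (i + 1) then (1 : ℝ) else 0) =
      ∑ i ∈ Finset.range t, if x = litNeg (c b (i + 1)) ∧ y = litNeg (c b i)
        then (1 : ℝ) else 0 := by
    rw [← Finset.sum_range_reflect]
    refine Finset.sum_congr rfl fun i hi => ?_
    have hi' := Finset.mem_range.1 hi
    simp only [snakeSeg, if_true]
    rw [show t - (t - 1 - i) = i + 1 by omega, show t - (t - 1 - i + 1) = i by omega]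
  rw [Fintype.sum_bool, h1, ← Finset.sum_add_distrib, ← Fin.sum_univ_eq_sum_range fun i =>
    (if x = litNeg (c b (i + 1)) ∧ y = litNeg (c b i) then (1 : ℝ) else 0) +
      if x = snakeSeg t c (b, false) i ∧ y = snakeSeg t c (b, false) (i + 1) then 1 else 0]
  refine Finset.sum_le_sum fun i _ => ?_
  simp only [snakeSeg, Bool.false_eq_true, if_false]
  by_cases h : ({litNeg (c b i), c b (i + 1)} : Finset (Lit n)) = {litNeg x, y}
  · have h2 : (litNeg (c b i) = litNeg x ∧ c b (i + 1) = y) ∨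
        (litNeg (c b i) = y ∧ c b (i + 1) = litNeg x) := by
      have h3 := h
      rw [← Finset.coe_inj] at h3
      push_cast at h3
      exact Set.pair_eq_pair_iff.1 h3
    rw [if_pos h]
    rcases h2 with ⟨h3, h4⟩ | ⟨h3, h4⟩
    · rw [if_pos (⟨(litNeg_injective h3).symm, h4.symm⟩ : x = c b i ∧ y = c b (i + 1))]
      have : (0 : ℝ) ≤ if x = litNeg (c b (i + 1)) ∧ y = litNeg (c b i) then 1 else 0 := by
        split_ifs <;> norm_num
      linarith
    · rw [if_pos (⟨by rw [h4, litNeg_litNeg], h3.symm⟩ :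
        x = litNeg (c b (i + 1)) ∧ y = litNeg (c b i))]
      have : (0 : ℝ) ≤ if x = c b i ∧ y = c b (i + 1) then 1 else 0 := by
        split_ifs <;> norm_num
      linarith
  · rw [if_neg h]
    exact add_nonneg (by split_ifs <;> norm_num) (by split_ifs <;> norm_num)

theorem IsSnake.not_satisfiable (hc : IsSnake t c) {m : ℕ} {F : Fin m → KClause 2 n}
    (h : ∀ ι : Bool × Fin t, ∃ j, clauseLits (F j) = {litNeg (c ι.1 ι.2), c ι.1 (ι.2 + 1)}) :
    ¬ FormulaSatisfiable F := by
  have h1 : ∀ b, Reaches F (c b 0) (litNeg (c b 0)) := by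
    intro b
    rw [← hc.finish]
    exact reaches_of_walk (c := c b) (k := t) (fun i hi => h (b, ⟨i, hi⟩)) (Nat.zero_le t) le_rfl
  refine not_satisfiable_of_reaches (h1 false) ?_
  have h2 := h1 true
  rwa [hc.start, litNeg_litNeg] at h2

end Snake

/-! ### The second moment bound -/

/-- The rank-one bound is applied with u(x) the weight of ¬x, v the weight, and g(x) = h(¬x). The
main term sums (p(1 - p))² over 2n literals; every correction carries a factor h(x) or h(¬x), with
total mass at most 8t. -/
theorem IsSnake.trace_le {n k : ℕ} {c : Bool → ℕ → Lit n} (hc : IsSnake (k + 1) c) {p a K γ Γ : ℝ}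
    (hp0 : 0 ≤ p) (hp1 : p ≤ 1) (ha : 0 ≤ a) (hK : 0 ≤ K)
    (hγ : 2 * n * (p * (1 - p)) * a = γ)
    (hKγ : (1 + 1 / ((k + 1 : ℕ) : ℝ)) * (1 + K) ≤ K * γ)
    (hθ3 : (1 + 1 / ((k + 1 : ℕ) : ℝ)) ^ k ≤ 3) (hγ1 : 1 ≤ a * γ ^ k)
    (hΓ : γ + 8 * ((k + 1 : ℕ) : ℝ) * K * a = Γ)
    {M : Matrix (Lit n) (Lit n) ℝ} (hM : ∀ x y, M x y =
      a * (litWeight p (litNeg x) * litWeight p y) + snakeMatrix (k + 1) c x y) :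
    ∑ x, (M ^ (k + 1)) x (litNeg x) * (M ^ (k + 1)) (litNeg x) x ≤
      (a * Γ ^ k) ^ 2 * (2 * n * (p * (1 - p)) ^ 2 + 16 * ((k + 1 : ℕ) : ℝ) *
        ((3 + 2 * K + 2 * K ^ 2) + (3 + 2 * K + 2 * K ^ 2) ^ 2)) := by
  set t : ℝ := ((k + 1 : ℕ) : ℝ) with ht
  have ht0 : 0 < t := by rw [ht]; positivity
  set θ : ℝ := 1 + 1 / t with hθ
  have hθ1 : 1 ≤ θ := by rw [hθ]; have : 0 ≤ 1 / t := by positivity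
                         linarith
  set P := snakeMatrix (k + 1) c with hP
  set h := snakePot (k + 1) c with hh
  have hP0 : ∀ x y, 0 ≤ P x y := snakeMatrix_nonneg
  have hh0 : ∀ x, 0 ≤ h x := snakePot_nonneg
  have hh2 : ∀ x, h x ≤ 2 := hc.pot_le (Nat.succ_pos k)
  have hw0 := litWeight_nonneg (n := n) hp0 hp1
  have hw1 := litWeight_le_one (n := n) hp0 hp1
  have hsum : ∑ x, h x ≤ 8 * t := sum_snakePot_le
  have hPu : ∀ x, ∑ y, P x y * litWeight p (litNeg y) ≤ θ * h x := fun x =>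
    (sum_snakeMatrix_mul_le_pot (fun y => hw1 _) x).trans (le_mul_of_one_le_left (hh0 x) hθ1)
  have hPh : ∀ x, ∑ y, P x y * h y ≤ θ * h x := hc.sum_matrix_mul_pot_le
  have hvP : ∀ y, ∑ x, litWeight p x * P x y ≤ θ * h (litNeg y) := by
    intro y
    have h1 := sum_mul_snakeMatrix (t := k + 1) (c := c) (fun x => litWeight p (litNeg x)) y
    simp only [litNeg_litNeg] at h1
    rw [h1]
    exact hPu _
  have hgP : ∀ y, ∑ x, h (litNeg x) * P x y ≤ θ * h (litNeg y) := by
    intro y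
    rw [sum_mul_snakeMatrix]
    exact hPh _
  -- Γ' is the growth rate that the rank-one lemma asks for; it lies between γ and Γ because 0 ≤ ∑ v
  -- h ≤ 8t.
  set Γ' : ℝ := a * ∑ z, litWeight p z * (litWeight p (litNeg z) + K * h z) with hΓ'
  have hΓ'eq : Γ' = γ + K * a * ∑ z, litWeight p z * h z := by
    rw [hΓ', ← hγ]
    simp only [mul_add, litWeight_mul_litNeg, Finset.sum_add_distrib]
    simp only [Finset.sum_const, Finset.card_univ, Fintype.card_prod, Fintype.card_fin,
      Fintype.card_bool, nsmul_eq_mul, Finset.mul_sum]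
    push_cast
    congr 1
    · ring
    · exact Finset.sum_congr rfl fun z _ => by ring
  have hwh0 : 0 ≤ ∑ z, litWeight p z * h z :=
    Finset.sum_nonneg fun z _ => mul_nonneg (hw0 z) (hh0 z)
  have hwh : ∑ z, litWeight p z * h z ≤ 8 * t :=
    (Finset.sum_le_sum fun z _ => mul_le_of_le_one_left (hh0 z) (hw1 z)).trans hsum
  have hγΓ' : γ ≤ Γ' := by
    rw [hΓ'eq]
    exact le_add_of_nonneg_right (mul_nonneg (mul_nonneg hK ha) hwh0)
  have hΓ'Γ : Γ' ≤ Γ := by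
    rw [hΓ'eq, ← hΓ]
    have := mul_le_mul_of_nonneg_left hwh (mul_nonneg hK ha)
    linarith
  have hKpos : 0 < K := by
    rcases hK.eq_or_lt with h0 | h0
    · rw [← h0] at hKγ
      linarith
    · exact h0
  have hθγ : θ < γ := by
    refine lt_of_mul_lt_mul_left ?_ hK
    linarith
  have hγ0 : 0 < γ := by linarith
  have hr0 : 0 ≤ p * (1 - p) := mul_nonneg hp0 (by linarith)
  set Z : ℝ := a * Γ ^ k with hZ
  have hZ1 : 1 ≤ Z := hγ1.trans (mul_le_mul_of_nonneg_left
    (pow_le_pow_left₀ hγ0.le (hγΓ'.trans hΓ'Γ) k) ha)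
  set D : ℝ := 3 + 2 * K + 2 * K ^ 2 with hD
  have hD0 : 0 ≤ D := by positivity
  -- At y = ¬x the row and column factors agree, so their product is a square. In D, the 3 comes
  -- from P^(k + 1), and 2K + 2K² from expanding the square with u ≤ 1 and h ≤ 2.
  have hentry : ∀ x, (M ^ (k + 1)) x (litNeg x) ≤ Z * (litWeight p (litNeg x) ^ 2 + h x * D) := by
    intro x
    have h1 := pow_rank_one_add_le (u := fun x => litWeight p (litNeg x)) (v := litWeight p)
      (h := h) (g := fun x => h (litNeg x)) (θ := θ) (K := K) (Γ := Γ') hM hP0 (fun x => hw0 _) hw0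
      hh0 (fun x => hh0 _) ha (by linarith) hK hPu hPh hvP hgP rfl (hθγ.trans_le hγΓ')
      (hKγ.trans (mul_le_mul_of_nonneg_left hγΓ' hK)) k x (litNeg x)
    simp only [litNeg_litNeg] at h1
    have h2 : (P ^ (k + 1)) x (litNeg x) ≤ 3 * h x := by
      rw [pow_succ, Matrix.mul_apply]
      calc _ ≤ ∑ z, (P ^ k) x z * h z := Finset.sum_le_sum fun z _ =>
            mul_le_mul_of_nonneg_left (snakeMatrix_le_pot _ _) (matrix_pow_nonneg hP0 _ _ _)
        _ ≤ θ ^ k * h x := matrix_pow_mulVec_le hP0 (by linarith) hPh k x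
        _ ≤ _ := mul_le_mul_of_nonneg_right hθ3 (hh0 x)
    set u := litWeight p (litNeg x) with hu
    have hu0 : 0 ≤ u := hw0 _
    have hu1 : u ≤ 1 := hw1 _
    have h3 : a * Γ' ^ k * (u + K * h x) * (u + K * h x) ≤ Z * (u + K * h x) ^ 2 := by
      have h4 : a * Γ' ^ k ≤ Z := mul_le_mul_of_nonneg_left
        (pow_le_pow_left₀ (hγ0.le.trans hγΓ') hΓ'Γ k) ha
      calc _ = a * Γ' ^ k * (u + K * h x) ^ 2 := by ring
        _ ≤ _ := mul_le_mul_of_nonneg_right h4 (sq_nonneg _)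
    have h4 : (u + K * h x) ^ 2 ≤ u ^ 2 + h x * (2 * K + 2 * K ^ 2) := by
      have h5 : u * (K * h x) ≤ 1 * (K * h x) :=
        mul_le_mul_of_nonneg_right hu1 (mul_nonneg hK (hh0 x))
      have h6 : K ^ 2 * h x * h x ≤ K ^ 2 * h x * 2 :=
        mul_le_mul_of_nonneg_left (hh2 x) (mul_nonneg (sq_nonneg K) (hh0 x))
      linarith
    have h5 := mul_le_mul_of_nonneg_left h4 (zero_le_one.trans hZ1)
    have h6 : 3 * h x ≤ Z * (3 * h x) := le_mul_of_one_le_left (by linarith [hh0 x]) hZ1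
    calc _ ≤ 3 * h x + Z * (u + K * h x) ^ 2 := by linarith
      _ ≤ Z * (3 * h x) + Z * (u ^ 2 + h x * (2 * K + 2 * K ^ 2)) := by linarith
      _ = _ := by rw [hD]; ring
  have hMnn : ∀ x y, 0 ≤ (M ^ (k + 1)) x y := matrix_pow_nonneg (fun x y => by
    rw [hM]
    exact add_nonneg (mul_nonneg ha (mul_nonneg (hw0 _) (hw0 _))) (hP0 x y)) _
  have hZ0 : 0 ≤ Z := by linarith
  have hprod : ∀ x, (M ^ (k + 1)) x (litNeg x) * (M ^ (k + 1)) (litNeg x) x ≤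
      Z ^ 2 * ((p * (1 - p)) ^ 2 + D * (h x + h (litNeg x)) + 2 * D ^ 2 * h x) := by
    intro x
    have h1 := hentry x
    have h2 := hentry (litNeg x)
    rw [litNeg_litNeg] at h2
    refine (mul_le_mul h1 h2 (hMnn _ _) (mul_nonneg hZ0 (add_nonneg (sq_nonneg _)
      (mul_nonneg (hh0 x) hD0)))).trans ?_
    rw [← litWeight_mul_litNeg p x]
    have hu0 := hw0 x
    have hu1 : litWeight p x ^ 2 ≤ 1 := pow_le_one₀ (hw0 x) (hw1 x)
    have hv1 : litWeight p (litNeg x) ^ 2 ≤ 1 := pow_le_one₀ (hw0 _) (hw1 _)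
    have h3 := mul_le_mul_of_nonneg_right hv1 (mul_nonneg (hh0 (litNeg x)) hD0)
    have h4 := mul_le_mul_of_nonneg_right hu1 (mul_nonneg (hh0 x) hD0)
    have h5 := mul_le_mul_of_nonneg_left (hh2 (litNeg x)) (mul_nonneg (sq_nonneg D) (hh0 x))
    calc _ = Z ^ 2 * ((litWeight p x * litWeight p (litNeg x)) ^ 2 +
          litWeight p (litNeg x) ^ 2 * (h (litNeg x) * D) + litWeight p x ^ 2 * (h x * D) +
          D ^ 2 * h x * h (litNeg x)) := by ring
      _ ≤ _ := mul_le_mul_of_nonneg_left (by linarith) (sq_nonneg Z)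
  refine (Finset.sum_le_sum fun x _ => hprod x).trans ?_
  rw [← Finset.mul_sum, Finset.sum_add_distrib, Finset.sum_add_distrib, ← Finset.mul_sum,
    ← Finset.mul_sum, Finset.sum_add_distrib, sum_comp_litNeg h]
  refine mul_le_mul_of_nonneg_left ?_ (sq_nonneg Z)
  have h1 := mul_le_mul_of_nonneg_left hsum hD0
  have h2 := mul_le_mul_of_nonneg_left hsum (sq_nonneg D)
  simp only [Finset.sum_const, Finset.card_univ, Fintype.card_prod, Fintype.card_fin,
      Fintype.card_bool, nsmul_eq_mul]
  push_cast
  linarith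

/-- The pair of paths with the literals `w`. -/
def snakeOf {n k : ℕ} (w : Option (Bool × Fin k) → Lit n) (b : Bool) : ℕ → Lit n :=
  pathVertex (if b = true then litNeg (w none) else w none) (fun i => w (some (b, i)))
    (if b = true then w none else litNeg (w none))

theorem snakeOf_zero {n k : ℕ} (w : Option (Bool × Fin k) → Lit n) (b : Bool) :
    snakeOf w b 0 = if b = true then litNeg (w none) else w none := pathVertex_zero _ _ _

theorem snakeOf_last {n k : ℕ} (w : Option (Bool × Fin k) → Lit n) (b : Bool) :
    snakeOf w b (k + 1) = if b = true then w none else litNeg (w none) := pathVertex_last _ _ _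

theorem snakeOf_succ {n k : ℕ} (w : Option (Bool × Fin k) → Lit n) (b : Bool) (i : Fin k) :
    snakeOf w b (i + 1) = w (some (b, i)) := pathVertex_succ _ _ _ i

theorem isSnake_snakeOf {n k : ℕ} {w : Option (Bool × Fin k) → Lit n}
    (hw : Function.Injective fun v => (w v).1) : IsSnake (k + 1) (snakeOf w) := by
  refine ⟨by simp [snakeOf_zero], fun b => ?_, ?_⟩
  · cases b <;> simp [snakeOf_zero, snakeOf_last]
  · intro b b' i j hi hik hj h
    obtain ⟨i, rfl⟩ : ∃ i', i = i' + 1 := ⟨i - 1, by omega⟩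
    have h1 := snakeOf_succ w b ⟨i, by omega⟩
    dsimp only at h1
    rw [h1] at h
    rcases Nat.eq_zero_or_pos j with rfl | hj0
    · rw [snakeOf_zero] at h
      have h2 : (w (some (b, ⟨i, by omega⟩))).1 = (w none).1 := by
        rw [h]; split_ifs <;> simp
      exact absurd (hw h2) (by simp)
    · rcases hj.eq_or_lt with rfl | hj'
      · rw [snakeOf_last] at h
        have h2 : (w (some (b, ⟨i, by omega⟩))).1 = (w none).1 := by
          rw [h]; split_ifs <;> simp
        exact absurd (hw h2) (by simp)
      · obtain ⟨j, rfl⟩ : ∃ j', j = j' + 1 := ⟨j - 1, by omega⟩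
        have h2 := snakeOf_succ w b' ⟨j, by omega⟩
        dsimp only at h2
        rw [h2] at h
        have h3 := hw h
        simp only [Option.some.injEq, Prod.mk.injEq, Fin.mk.injEq] at h3
        exact ⟨h3.1, by omega⟩

/-- A path of length 1 would join x to ¬x directly, which is no clause on two variables; hence the
length k + 2. -/
theorem IsSnake.fst_ne_succ {n k : ℕ} {c : Bool → ℕ → Lit n} (hc : IsSnake (k + 2) c) (b : Bool)
    {i : ℕ} (hi : i < k + 2) : (litNeg (c b i)).1 ≠ (c b (i + 1)).1 := by
  intro h
  rw [litNeg_fst] at h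
  rcases Nat.eq_zero_or_pos i with rfl | hi0
  · have := (hc.inner b b (0 + 1) 0 (by omega) (by omega) (by omega) h.symm).2
    omega
  · have := (hc.inner b b i (i + 1) hi0 hi (by omega) h).2
    omega

/-- Inner literals contribute r = p(1 - p) each. The ends of the two paths contribute the squared
weights of ¬x and of x, together r², so all snakes are equally likely. Each path is multiplied by
the weight of its first literal to let the product telescope. -/
theorem IsSnake.prod_litWeight {n t : ℕ} {c : Bool → ℕ → Lit n} (hc : IsSnake t c) {p : ℝ}
    (hr : p * (1 - p) ≠ 0) :
    ∏ ι : Bool × Fin t, (litWeight p (litNeg (c ι.1 ι.2)) * litWeight p (c ι.1 (ι.2 + 1))) =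
      (p * (1 - p)) ^ (2 * t) := by
  have h1 : ∀ b, (∏ i : Fin t, (litWeight p (litNeg (c b i)) * litWeight p (c b (i + 1)))) *
      litWeight p (c b 0) = (p * (1 - p)) ^ t * litWeight p (litNeg (c b 0)) := by
    intro b
    rw [Finset.prod_mul_distrib, mul_assoc,
      Fin.prod_univ_eq_prod_range (fun i => litWeight p (c b (i + 1))) t,
      ← Finset.prod_range_succ' (fun i => litWeight p (c b i)) t, Finset.prod_range_succ,
      hc.finish, ← mul_assoc, Fin.prod_univ_eq_prod_range (fun i => litWeight p (litNeg (c b i))) t,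
      ← Finset.prod_mul_distrib]
    simp [mul_comm (litWeight p (litNeg _)), litWeight_mul_litNeg]
  have h2 := h1 true
  rw [hc.start, litNeg_litNeg] at h2
  rw [Fintype.prod_prod_type, Fintype.prod_bool]
  refine mul_right_cancel₀ hr ?_
  rw [← litWeight_mul_litNeg p (c false 0)]
  calc _ = ((∏ i : Fin t, (litWeight p (litNeg (c true i)) * litWeight p (c true (i + 1)))) *
        litWeight p (litNeg (c false 0))) *
        ((∏ i : Fin t, (litWeight p (litNeg (c false i)) * litWeight p (c false (i + 1)))) *
        litWeight p (c false 0)) := by ring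
    _ = _ := by
      rw [h2, h1 false, litWeight_mul_litNeg]
      calc _ = (p * (1 - p)) ^ t * (p * (1 - p)) ^ t *
            (litWeight p (c false 0) * litWeight p (litNeg (c false 0))) := by ring
        _ = _ := by rw [litWeight_mul_litNeg]; ring

/-- Once the end literal x is fixed, the inner literals of the two paths are summed independently,
and each path gives one entry of M^(k + 1). -/
theorem sum_prod_snakeOf {n k : ℕ} (M : Matrix (Lit n) (Lit n) ℝ) :
    ∑ w : Option (Bool × Fin k) → Lit n,
      ∏ ι : Bool × Fin (k + 1), M (snakeOf w ι.1 ι.2) (snakeOf w ι.1 (ι.2 + 1)) =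
    ∑ x, (M ^ (k + 1)) x (litNeg x) * (M ^ (k + 1)) (litNeg x) x := by
  rw [← (Equiv.piOptionEquivProd (β := fun _ : Option (Bool × Fin k) => Lit n)).symm.sum_comp,
    Fintype.sum_prod_type]
  refine Finset.sum_congr rfl fun x _ => ?_
  rw [← (Equiv.curry Bool (Fin k) (Lit n)).symm.sum_comp]
  let f : Bool → (Fin k → Lit n) → ℝ := fun b A => ∏ i : Fin (k + 1),
    M (pathVertex (if b = true then litNeg x else x) A (if b = true then x else litNeg x) i)
      (pathVertex (if b = true then litNeg x else x) A (if b = true then x else litNeg x) (i + 1))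
  have h1 := Finset.prod_univ_sum (fun _ : Bool => (Finset.univ : Finset (Fin k → Lit n))) f
  rw [Fintype.piFinset_univ] at h1
  calc _ = ∑ A : Bool → Fin k → Lit n, ∏ b, f b (A b) := by
        refine Finset.sum_congr rfl fun A _ => ?_
        rw [Fintype.prod_prod_type]
        rfl
    _ = _ := by
        rw [← h1, Fintype.prod_bool, mul_comm]
        simp only [f, sum_prod_pathVertex, if_true, Bool.false_eq_true, if_false]

/-- The second moment bound on the probability of unsatisfiability. -/
theorem le_one_sub_satProb_mul {n k : ℕ} (hn : 2 ≤ n) (m : ℕ) {p a K γ Γ : ℝ}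
    (hp0 : 0 < p) (hp1 : p < 1) (ha : m / (n.choose 2 : ℝ) = a) (hK : 0 ≤ K)
    (hγ : 2 * n * (p * (1 - p)) * a = γ)
    (hKγ : (1 + 1 / ((k + 2 : ℕ) : ℝ)) * (1 + K) ≤ K * γ)
    (hθ3 : (1 + 1 / ((k + 2 : ℕ) : ℝ)) ^ (k + 1) ≤ 3) (hγ1 : 1 ≤ a * γ ^ (k + 1))
    (hΓ : γ + 8 * ((k + 2 : ℕ) : ℝ) * K * a = Γ) :
    (m.descFactorial (2 * (k + 2))) * (2 ^ (2 * k + 3) * n.descFactorial (2 * k + 3) *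
      ((p * (1 - p)) / (n.choose 2 : ℝ)) ^ (2 * (k + 2))) ≤
    (1 - satProb 2 n m p) * ((a * Γ ^ (k + 1)) ^ 2 *
      (2 * n * (p * (1 - p)) ^ 2 + 16 * ((k + 2 : ℕ) : ℝ) *
        ((3 + 2 * K + 2 * K ^ 2) + (3 + 2 * K + 2 * K ^ 2) ^ 2))) := by
  classical
  set B : ℝ := (a * Γ ^ (k + 1)) ^ 2 *
      (2 * n * (p * (1 - p)) ^ 2 + 16 * ((k + 2 : ℕ) : ℝ) *
        ((3 + 2 * K + 2 * K ^ 2) + (3 + 2 * K + 2 * K ^ 2) ^ 2)) with hB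
  have hr : 0 < p * (1 - p) := mul_pos hp0 (by linarith)
  have ha0 : 0 ≤ a := by rw [← ha]; positivity
  have hB0 : 0 ≤ B := by positivity
  have hq := clauseProb_nonneg (k := 2) (n := n) hp0.le hp1.le
  have hq1 := sum_clauseProb hn p
  -- The index `none` stands for the end literal x, the others for inner positions. Snakes are
  -- injective choices of variables with arbitrary signs.
  let V : Type := Option (Bool × Fin (k + 1))
  let lit : (V ↪ Fin n) × (V → Bool) → V → Lit n := fun w v => (w.1 v, w.2 v)
  let e : (V ↪ Fin n) × (V → Bool) → Bool × Fin (k + 2) → Finset (Lit n) := fun w ι =>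
    {litNeg (snakeOf (lit w) ι.1 ι.2), snakeOf (lit w) ι.1 (ι.2 + 1)}
  have hsnake : ∀ w, IsSnake (k + 2) (snakeOf (lit w)) := fun w =>
    isSnake_snakeOf w.1.injective
  have hlit : Function.Injective lit := by
    intro w w' h
    refine Prod.ext (DFunLike.ext _ _ fun v => ?_) (funext fun v => ?_)
    · exact congrArg Prod.fst (congrFun h v)
    · exact congrArg Prod.snd (congrFun h v)
  have hR : ∀ w, ∑ w', ∏ i, (m * fiberWeight (clauseProb (k := 2) p) clauseLits (e w' i) +
      ∑ i', if e w i' = e w' i then (1 : ℝ) else 0) ≤ B := by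
    intro w
    set M : Matrix (Lit n) (Lit n) ℝ := fun x y =>
      a * (litWeight p (litNeg x) * litWeight p y) + snakeMatrix (k + 2) (snakeOf (lit w)) x y
      with hM
    have hM0 : ∀ x y, 0 ≤ M x y := fun x y => add_nonneg (mul_nonneg ha0 (mul_nonneg
      (litWeight_nonneg hp0.le hp1.le _) (litWeight_nonneg hp0.le hp1.le _)))
      (snakeMatrix_nonneg x y)
    calc _ ≤ ∑ w', ∏ ι : Bool × Fin (k + 2),
          M (snakeOf (lit w') ι.1 ι.2) (snakeOf (lit w') ι.1 (ι.2 + 1)) := by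
          refine Finset.sum_le_sum fun w' _ => Finset.prod_le_prod (fun ι _ => add_nonneg
            (mul_nonneg (Nat.cast_nonneg m) (fiberWeight_nonneg hq _ _))
            (Finset.sum_nonneg fun i _ => by split_ifs <;> norm_num)) fun ι _ => ?_
          refine add_le_add ?_ (sum_edge_le_snakeMatrix _ _)
          refine (mul_le_mul_of_nonneg_left (pairProb_le hp0.le hp1.le _ _)
            (Nat.cast_nonneg m)).trans (le_of_eq ?_)
          rw [← ha]; ring
      -- Distinctness is dropped for the second snake only; the first must remain a snake for the
      -- bounds on its potential.
      _ ≤ ∑ w' : V → Lit n, ∏ ι : Bool × Fin (k + 2),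
          M (snakeOf w' ι.1 ι.2) (snakeOf w' ι.1 (ι.2 + 1)) := by
          rw [← Finset.sum_image (s := Finset.univ) (g := lit)
            (f := fun w' : V → Lit n => ∏ ι : Bool × Fin (k + 2),
              M (snakeOf w' ι.1 ι.2) (snakeOf w' ι.1 (ι.2 + 1))) hlit.injOn]
          exact Finset.sum_le_sum_of_subset_of_nonneg (Finset.subset_univ _)
            fun w' _ _ => Finset.prod_nonneg fun ι _ => hM0 _ _
      _ = _ := sum_prod_snakeOf M
      _ ≤ B := (hsnake w).trace_le hp0.le hp1.le ha0 hK hγ hKγ hθ3 hγ1 hΓ fun x y => rfl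
  have h1 := second_moment_pattern (m := m) hq hq1 clauseLits e hB0 hR
  have h2 : ∀ w, ∏ i, fiberWeight (clauseProb (k := 2) p) clauseLits (e w i) =
      ((p * (1 - p)) / (n.choose 2 : ℝ)) ^ (2 * (k + 2)) := by
    intro w
    have h3 : ∀ ι, fiberWeight (clauseProb (k := 2) p) clauseLits (e w ι) = ((n.choose 2 : ℝ))⁻¹ *
        (litWeight p (litNeg (snakeOf (lit w) ι.1 ι.2)) *
          litWeight p (snakeOf (lit w) ι.1 (ι.2 + 1))) := fun ι =>
      pairProb_of_ne p ((hsnake w).fst_ne_succ ι.1 ι.2.2)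
    simp only [h3]
    rw [Finset.prod_mul_distrib, (hsnake w).prod_litWeight hr.ne', div_pow]
    simp [div_eq_inv_mul]
  have h3 : (1 - satProb 2 n m p) =
      ∑ F : Fin m → KClause 2 n with ¬ FormulaSatisfiable F, ∏ j, clauseProb p (F j) := by
    rw [← eq_sub_iff_add_eq'.2 (satProb_add_eq_one hn m p)]
  have h4 : (∑ F : Fin m → KClause 2 n with ∃ w, ∀ i, ∃ j, clauseLits (F j) = e w i,
      ∏ j, clauseProb p (F j)) ≤ 1 - satProb 2 n m p := by
    rw [h3]
    refine Finset.sum_le_sum_of_subset_of_nonneg ?_ fun F _ _ =>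
      Finset.prod_nonneg fun j _ => hq _
    intro F hF
    obtain ⟨w, hw⟩ := (Finset.mem_filter.1 hF).2
    exact Finset.mem_filter.2 ⟨Finset.mem_univ _, (hsnake w).not_satisfiable hw⟩
  refine (le_of_eq ?_).trans (h1.trans (mul_le_mul_of_nonneg_right ?_ hB0))
  · have hV : Fintype.card V = 2 * k + 3 := by
      simp only [V, Fintype.card_option, Fintype.card_prod, Fintype.card_bool, Fintype.card_fin]
      ring
    have hI : Fintype.card (Bool × Fin (k + 2)) = 2 * (k + 2) := by
      simp only [Fintype.card_prod, Fintype.card_bool, Fintype.card_fin]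
    have hS : Fintype.card ((V ↪ Fin n) × (V → Bool)) =
        n.descFactorial (2 * k + 3) * 2 ^ (2 * k + 3) := by
      rw [Fintype.card_prod, Fintype.card_embedding_eq, Fintype.card_fun, hV, Fintype.card_fin,
        Fintype.card_bool]
    simp only [h2, Finset.sum_const, Finset.card_univ, nsmul_eq_mul]
    rw [hI, hS]
    push_cast
    ring
  · convert h4

/-! ### Asymptotics -/

theorem satProb_nonneg {n m : ℕ} {p : ℝ} (hp0 : 0 ≤ p) (hp1 : p ≤ 1) : 0 ≤ satProb 2 n m p :=
  Finset.sum_nonneg fun _ _ => Finset.prod_nonneg fun _ _ => clauseProb_nonneg hp0 hp1 _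

theorem satProb_le_one {n m : ℕ} {p : ℝ} (hn : 2 ≤ n) (hp0 : 0 ≤ p) (hp1 : p ≤ 1) :
    satProb 2 n m p ≤ 1 := by
  classical
  rw [← satProb_add_eq_one hn m p]
  exact le_add_of_nonneg_right (Finset.sum_nonneg fun _ _ =>
    Finset.prod_nonneg fun _ _ => clauseProb_nonneg hp0 hp1 _)

/-- Uniformity in m is needed to average over a Poisson number of clauses and to bound an infimum
over m. -/
theorem eventually_le_satProb {p ε η : ℝ} (hp0 : 0 < p) (hp1 : p < 1) (hε : 0 < ε) (hη : 0 < η) :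
    ∀ᶠ n : ℕ in atTop, ∀ m : ℕ, (m : ℝ) ≤ (1 - ε) * (1 / (4 * p * (1 - p))) * n →
      1 - η ≤ satProb 2 n m p := by
  have hr : 0 < p * (1 - p) := mul_pos hp0 (by linarith)
  set r := p * (1 - p) with hrdef
  set ε' := min ε (1 / 2) with hε'
  have hε'0 : 0 < ε' := lt_min hε (by norm_num)
  have hε'1 : ε' ≤ 1 / 2 := min_le_right _ _
  have hεε' : ε' ≤ ε := min_le_left _ _
  -- Half of ε' pays for n - 1 in place of n in 2n · r · m/N = 4rm/(n - 1).
  set ρ := 1 - ε' / 2 with hρ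
  have hρ0 : 0 ≤ ρ := by rw [hρ]; linarith
  have hρ1 : ρ < 1 := by rw [hρ]; linarith
  have hsum : Summable fun s : ℕ => 2 * ((s : ℝ) + 1) ^ 2 * ρ ^ s := by
    have h := fun k => summable_pow_mul_geometric_of_norm_lt_one (R := ℝ) k (r := ρ)
      (by rwa [Real.norm_of_nonneg hρ0])
    refine ((((h 2).add ((h 1).mul_left 2)).add (h 0)).mul_left 2).congr fun s => ?_
    ring
  set T := ∑' s : ℕ, 2 * ((s : ℝ) + 1) ^ 2 * ρ ^ s with hT
  have hev1 : ∀ᶠ n : ℕ in atTop, ρ / (ε' / 2) ≤ (n : ℝ) :=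
    tendsto_natCast_atTop_atTop.eventually_ge_atTop _
  have hev2 : ∀ᶠ n : ℕ in atTop, T / (2 * r * η) ≤ (n : ℝ) :=
    tendsto_natCast_atTop_atTop.eventually_ge_atTop _
  filter_upwards [hev1, hev2, eventually_ge_atTop 2] with n h1 h2 hn m hm
  have hn' : (2 : ℝ) ≤ n := by exact_mod_cast hn
  have hN : (n.choose 2 : ℝ) = n * (n - 1) / 2 := Nat.cast_choose_two ℝ n
  have hN0 : (0 : ℝ) < n.choose 2 := by
    rw [hN]
    have : (0 : ℝ) < n - 1 := by linarith
    positivity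
  set a : ℝ := m / (n.choose 2 : ℝ) with ha
  have ha0 : 0 ≤ a := by positivity
  have hm' : 4 * r * m ≤ (1 - ε') * n := by
    have h3 : (1 - ε) * (1 / (4 * p * (1 - p))) * n = (1 - ε) * n / (4 * r) := by
      rw [hrdef]; field_simp
    rw [h3, le_div_iff₀ (by positivity)] at hm
    have h4 : (1 - ε) * (n : ℝ) ≤ (1 - ε') * n :=
      mul_le_mul_of_nonneg_right (by linarith) (by linarith)
    linarith
  have hγ : 2 * n * r * a ≤ ρ := by
    have h3 : 2 * n * r * a = 4 * r * m / (n - 1) := by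
      have : (n : ℝ) - 1 ≠ 0 := by linarith
      have : (n : ℝ) ≠ 0 := by linarith
      rw [ha, hN]
      field_simp
      ring
    rw [h3, div_le_iff₀ (by linarith)]
    rw [div_le_iff₀ (by linarith)] at h1
    refine hm'.trans ?_
    rw [hρ] at h1 ⊢
    linarith
  have haT : a * T ≤ η := by
    have hT0 : 0 ≤ T := tsum_nonneg fun s => by positivity
    have h3 : T ≤ 2 * r * η * n := by
      rw [div_le_iff₀ (by positivity)] at h2
      linarith
    calc a * T ≤ a * (2 * r * η * n) := mul_le_mul_of_nonneg_left h3 ha0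
      _ = (2 * n * r * a) * η := by ring
      _ ≤ 1 * η := mul_le_mul_of_nonneg_right (hγ.trans hρ1.le) hη.le
      _ = η := one_mul η
  have h3 := one_sub_satProb_le hn m hp0.le hp1.le
  have h4 : ∑ s ∈ Finset.Icc 1 n, 2 * ((s : ℝ) + 1) ^ 2 * (2 * n * r * a) ^ s ≤ T := by
    calc _ ≤ ∑ s ∈ Finset.Icc 1 n, 2 * ((s : ℝ) + 1) ^ 2 * ρ ^ s :=
          Finset.sum_le_sum fun s _ => mul_le_mul_of_nonneg_left
            (pow_le_pow_left₀ (by positivity) hγ s) (by positivity)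
      _ ≤ T := hsum.sum_le_tsum _ fun s _ => by positivity
  have h5 := h3.trans (mul_le_mul_of_nonneg_left h4 ha0)
  linarith

theorem le_descFactorial {m j : ℕ} (hm : 0 < m) (hj : j ≤ m) :
    (1 - (j : ℝ) ^ 2 / m) * (m : ℝ) ^ j ≤ m.descFactorial j := by
  have hm' : (0 : ℝ) < m := by exact_mod_cast hm
  have hj' : (j : ℝ) / m ≤ 1 := div_le_one_of_le₀ (by exact_mod_cast hj) hm'.le
  have h1 : 1 - (j : ℝ) ^ 2 / m ≤ (1 - (j : ℝ) / m) ^ j := by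
    have := one_add_mul_le_pow (a := -((j : ℝ) / m)) (by linarith) j
    calc 1 - (j : ℝ) ^ 2 / m = 1 + (j : ℝ) * -((j : ℝ) / m) := by ring
      _ ≤ _ := this
      _ = _ := by rw [← sub_eq_add_neg]
  calc _ ≤ (1 - (j : ℝ) / m) ^ j * (m : ℝ) ^ j :=
        mul_le_mul_of_nonneg_right h1 (by positivity)
    _ = ((m - j : ℕ) : ℝ) ^ j := by
        rw [← mul_pow, Nat.cast_sub hj, sub_mul, div_mul_cancel₀ _ hm'.ne', one_mul]
    _ ≤ ((m + 1 - j : ℕ) : ℝ) ^ j :=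
        pow_le_pow_left₀ (by positivity) (by exact_mod_cast (by omega)) j
    _ ≤ _ := by exact_mod_cast Nat.pow_sub_le_descFactorial m j

/-- Both sides of the second moment inequality are compared with A = 2n r² (a γ^(k + 1))². With x =
t²/n, the falling factorials cost (1 - 4x)², replacing Γ by γ costs exp(8Kx/r), and the corrections
of order t cost the last factor. -/
theorem satProb_le_of_supercritical {n k m : ℕ} {p K γ x : ℝ} (hn : 2 ≤ n) (hnm : n ≤ m)
    (hp0 : 0 < p) (hp1 : p < 1) (hK : 0 ≤ K)
    (hγ : 2 * n * (p * (1 - p)) * (m / (n.choose 2 : ℝ)) = γ)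
    (hKγ : (1 + 1 / ((k + 2 : ℕ) : ℝ)) * (1 + K) ≤ K * γ) (hγ1 : 2 * (n : ℝ) ≤ γ ^ (k + 2))
    (hx : ((k + 2 : ℕ) : ℝ) ^ 2 / n = x) (hx4 : 4 * x ≤ 1) :
    satProb 2 n m p ≤ 1 - (1 - 4 * x) ^ 2 / (Real.exp (8 * K / (p * (1 - p)) * x) *
      (1 + 8 * ((3 + 2 * K + 2 * K ^ 2) + (3 + 2 * K + 2 * K ^ 2) ^ 2) / (p * (1 - p)) ^ 2 * x)) := by
  have hr : 0 < p * (1 - p) := mul_pos hp0 (by linarith)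
  have hr1 : p * (1 - p) ≤ 1 := mul_le_one₀ hp1.le (by linarith) (by linarith)
  have hn0 : (0 : ℝ) < n := by exact_mod_cast (by omega : 0 < n)
  have hN0 : (0 : ℝ) < n.choose 2 := by exact_mod_cast Nat.choose_pos hn
  have hm0 : (0 : ℝ) < m := by exact_mod_cast (by omega : 0 < m)
  set t : ℝ := ((k + 2 : ℕ) : ℝ) with ht
  have ht1 : 1 ≤ t := by rw [ht]; exact_mod_cast (by omega : 1 ≤ k + 2)
  set r := p * (1 - p) with hrdef
  set N : ℝ := (n.choose 2 : ℝ) with hN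
  set a : ℝ := m / N with ha
  have ha0 : 0 < a := by positivity
  have hγ0 : 0 < γ := by rw [← hγ]; positivity
  set D : ℝ := (3 + 2 * K + 2 * K ^ 2) + (3 + 2 * K + 2 * K ^ 2) ^ 2 with hD
  have hD0 : 0 < D := by positivity
  have hx0 : 0 ≤ x := by rw [← hx]; positivity
  have ht2 : t ^ 2 = x * n := by rw [← hx]; field_simp
  have htt : t ≤ t ^ 2 := le_self_pow₀ ht1 two_ne_zero
  have htn : t ≤ x * n := by rwa [← ht2]
  have hθ3 : (1 + 1 / t) ^ (k + 1) ≤ 3 := by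
    have h1 : 1 + 1 / t ≤ Real.exp (1 / t) := by
      rw [add_comm]; exact Real.add_one_le_exp _
    calc (1 + 1 / t) ^ (k + 1) ≤ (Real.exp (1 / t)) ^ (k + 1) :=
          pow_le_pow_left₀ (by positivity) h1 _
      _ = Real.exp (((k + 1 : ℕ) : ℝ) * (1 / t)) := (Real.exp_nat_mul _ _).symm
      _ ≤ Real.exp 1 := by
          refine Real.exp_le_exp.2 ?_
          rw [mul_one_div]
          refine div_le_one_of_le₀ ?_ (by positivity)
          rw [ht]; exact_mod_cast (by omega)
      _ ≤ 3 := by linarith [Real.exp_one_lt_d9]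
  -- Since γ^(k + 2) = 2n r · a γ^(k + 1) and r ≤ 1, this follows from 2n ≤ γ^(k + 2).
  have hγ1' : 1 ≤ a * γ ^ (k + 1) := by
    have h1 : 2 * n * r * (a * γ ^ (k + 1)) = γ ^ (k + 2) := by
      rw [pow_succ γ (k + 1), ← hγ]; ring
    by_contra! h2
    have h3 : 2 * n * r * (a * γ ^ (k + 1)) < 2 * n * r * 1 :=
      mul_lt_mul_of_pos_left h2 (by positivity)
    have h4 : 2 * n * r ≤ 2 * n * 1 := mul_le_mul_of_nonneg_left hr1 (by positivity)
    linarith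
  have hmain := le_one_sub_satProb_mul (k := k) hn m hp0 hp1 rfl hK hγ hKγ hθ3 hγ1' rfl
  set A : ℝ := 2 * n * r ^ 2 * (a * γ ^ (k + 1)) ^ 2 with hA
  have hA0 : 0 < A := by positivity
  have hAeq : A = (m : ℝ) ^ (2 * (k + 2)) * (2 ^ (2 * k + 3) * (n : ℝ) ^ (2 * k + 3) *
      (r / N) ^ (2 * (k + 2))) := by
    have h1 : (m : ℝ) ^ (2 * (k + 2)) * (r / N) ^ (2 * (k + 2)) = (r * a) ^ (2 * (k + 2)) := by
      rw [← mul_pow, ha, ← mul_div_assoc, ← mul_div_assoc, mul_comm r]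
    calc A = (2 * n) ^ (2 * k + 3) * (r * a) ^ (2 * (k + 2)) := by
          rw [hA, ← hγ]; ring_nf
      _ = _ := by
          rw [← h1, mul_pow]
          generalize (r / N) ^ (2 * (k + 2)) = B
          ring
  have h2t : 2 * (k + 2) ≤ n := by
    have h1 : 4 * t ^ 2 ≤ n := by
      have := mul_le_mul_of_nonneg_right hx4 hn0.le
      rw [ht2]; linarith
    have h2 : 2 * t ≤ n := by linarith
    rw [ht] at h2
    exact_mod_cast h2
  have hEX : (1 - 4 * x) ^ 2 * A ≤ (m.descFactorial (2 * (k + 2))) *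
      (2 ^ (2 * k + 3) * n.descFactorial (2 * k + 3) * (r / N) ^ (2 * (k + 2))) := by
    have h1 : (1 - 4 * x) * (m : ℝ) ^ (2 * (k + 2)) ≤ m.descFactorial (2 * (k + 2)) := by
      refine le_trans (mul_le_mul_of_nonneg_right ?_ (by positivity))
        (le_descFactorial (m := m) (by omega) (h2t.trans hnm))
      have h3 : ((2 * (k + 2) : ℕ) : ℝ) ^ 2 / m ≤ 4 * x := by
        rw [div_le_iff₀ hm0]
        have h4 : ((2 * (k + 2) : ℕ) : ℝ) = 2 * t := by rw [ht]; push_cast; ring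
        have h5 : x * n ≤ x * m := mul_le_mul_of_nonneg_left (by exact_mod_cast hnm) hx0
        rw [h4, mul_pow, ht2]
        linarith
      linarith
    have h2 : (1 - 4 * x) * (n : ℝ) ^ (2 * k + 3) ≤ n.descFactorial (2 * k + 3) := by
      refine le_trans (mul_le_mul_of_nonneg_right ?_ (by positivity))
        (le_descFactorial (m := n) (by omega) (by omega))
      have h3 : ((2 * k + 3 : ℕ) : ℝ) ^ 2 / n ≤ 4 * x := by
        rw [div_le_iff₀ hn0]
        have h4 : ((2 * k + 3 : ℕ) : ℝ) ≤ 2 * t := by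
          rw [ht]; exact_mod_cast (by omega)
        have h5 := pow_le_pow_left₀ (by positivity) h4 2
        rw [mul_pow, ht2] at h5
        linarith
      linarith
    have h3 : 0 ≤ 1 - 4 * x := by linarith
    calc _ = ((1 - 4 * x) * (m : ℝ) ^ (2 * (k + 2))) * (2 ^ (2 * k + 3) *
          ((1 - 4 * x) * (n : ℝ) ^ (2 * k + 3)) * (r / N) ^ (2 * (k + 2))) := by
          rw [hAeq]; ring
      _ ≤ _ := by gcongr
  have hsat : 0 ≤ 1 - satProb 2 n m p := by linarith [satProb_le_one (m := m) hn hp0.le hp1.le]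
  have hB : (a * (γ + 8 * t * K * a) ^ (k + 1)) ^ 2 * (2 * n * r ^ 2 + 16 * t * D) ≤
      A * (Real.exp (8 * K / r * x) * (1 + 8 * D / r ^ 2 * x)) := by
    have h1 : γ + 8 * t * K * a ≤ γ * (1 + 4 * K * t / (n * r)) := by
      rw [← hγ]
      refine le_of_eq ?_
      field_simp
      ring
    have h2 : 1 + 4 * K * t / (n * r) ≤ Real.exp (4 * K * t / (n * r)) := by
      rw [add_comm]; exact Real.add_one_le_exp _
    have h3 : (1 + 4 * K * t / (n * r)) ^ (2 * (k + 1)) ≤ Real.exp (8 * K / r * x) := by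
      calc _ ≤ (Real.exp (4 * K * t / (n * r))) ^ (2 * (k + 1)) :=
            pow_le_pow_left₀ (by positivity) h2 _
        _ = Real.exp (((2 * (k + 1) : ℕ) : ℝ) * (4 * K * t / (n * r))) :=
            (Real.exp_nat_mul _ _).symm
        _ ≤ Real.exp (8 * K / r * x) := by
            refine Real.exp_le_exp.2 ?_
            have h4 : ((2 * (k + 1) : ℕ) : ℝ) ≤ 2 * t := by
              rw [ht]; exact_mod_cast (by omega)
            calc _ ≤ 2 * t * (4 * K * t / (n * r)) :=
                  mul_le_mul_of_nonneg_right h4 (by positivity)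
              _ = 8 * K / r * x := by rw [← hx]; field_simp; ring
    have h4 : 2 * n * r ^ 2 + 16 * t * D ≤ 2 * n * r ^ 2 * (1 + 8 * D / r ^ 2 * x) := by
      have h5 : 2 * n * r ^ 2 * (1 + 8 * D / r ^ 2 * x) = 2 * n * r ^ 2 + 16 * (x * n) * D := by
        field_simp
        ring
      rw [h5]
      have := mul_le_mul_of_nonneg_right htn hD0.le
      linarith
    calc _ ≤ (a * (γ * (1 + 4 * K * t / (n * r))) ^ (k + 1)) ^ 2 *
          (2 * n * r ^ 2 * (1 + 8 * D / r ^ 2 * x)) := by gcongr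
      _ = A * ((1 + 4 * K * t / (n * r)) ^ (2 * (k + 1)) * (1 + 8 * D / r ^ 2 * x)) := by
          rw [hA, mul_pow γ]; ring
      _ ≤ _ := by gcongr
  have hfin := hEX.trans (hmain.trans (mul_le_mul_of_nonneg_left hB hsat))
  set Q : ℝ := Real.exp (8 * K / r * x) * (1 + 8 * D / r ^ 2 * x) with hQ
  have hQ0 : 0 < Q := by positivity
  have h1 : (1 - 4 * x) ^ 2 ≤ (1 - satProb 2 n m p) * Q := by
    refine le_of_mul_le_mul_right ?_ hA0
    linarith
  have h2 : (1 - 4 * x) ^ 2 / Q ≤ 1 - satProb 2 n m p := (div_le_iff₀ hQ0).2 h1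
  linarith

theorem eventually_satProb_le {p ε η : ℝ} (hp0 : 0 < p) (hp1 : p < 1) (hε : 0 < ε) (hη : 0 < η) :
    ∀ᶠ n : ℕ in atTop, ∀ m : ℕ, (1 + ε) * (1 / (4 * p * (1 - p))) * n ≤ (m : ℝ) →
      satProb 2 n m p ≤ η := by
  have hr : 0 < p * (1 - p) := mul_pos hp0 (by linarith)
  set r := p * (1 - p) with hrdef
  -- K solves (1 + ε/2)(1 + K) = K(1 + ε), so one K serves for every γ ≥ 1 + ε once 1/t ≤ ε/2.
  set K : ℝ := (2 + ε) / ε with hK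
  have hK0 : 0 < K := by positivity
  -- The length is about n^(1/4): short enough for t²/n → 0, long enough for (1 + ε)^t ≥ 2n.
  set t : ℕ → ℕ := fun n => Nat.sqrt (Nat.sqrt n) with ht
  have htn : ∀ n, t n ^ 4 ≤ n := fun n => by
    calc t n ^ 4 = (t n ^ 2) ^ 2 := by ring
      _ ≤ (Nat.sqrt n) ^ 2 := Nat.pow_le_pow_left (Nat.sqrt_le' _) 2
      _ ≤ n := Nat.sqrt_le' n
  have hnt : ∀ n, n ≤ (t n + 1) ^ 4 := fun n => by
    have h1 : Nat.sqrt n + 1 ≤ (t n + 1) ^ 2 := Nat.succ_le_of_lt (Nat.lt_succ_sqrt' _)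
    calc n ≤ (Nat.sqrt n + 1) ^ 2 := (Nat.lt_succ_sqrt' n).le
      _ ≤ ((t n + 1) ^ 2) ^ 2 := Nat.pow_le_pow_left h1 2
      _ = _ := by ring
  have httop : Tendsto t atTop atTop := by
    refine tendsto_atTop.2 fun b => ?_
    filter_upwards [eventually_ge_atTop (b ^ 4)] with n hn
    have h1 : b ^ 2 ≤ Nat.sqrt n := Nat.le_sqrt'.2 (by rw [← pow_mul]; exact hn)
    exact Nat.le_sqrt'.2 h1
  set x : ℕ → ℝ := fun n => (t n : ℝ) ^ 2 / n with hx
  have hx0 : Tendsto x atTop (𝓝 0) := by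
    have h1 : Tendsto (fun n => 1 / (t n : ℝ)) atTop (𝓝 0) :=
      tendsto_one_div_atTop_nhds_zero_nat.comp httop
    refine squeeze_zero' (Eventually.of_forall fun n => by positivity) ?_ h1
    filter_upwards [httop.eventually_ge_atTop 1, eventually_ge_atTop 1] with n h2 h3
    have h2' : (1 : ℝ) ≤ t n := by exact_mod_cast h2
    have h3' : (0 : ℝ) < n := by exact_mod_cast h3
    rw [hx]
    dsimp only
    rw [div_le_div_iff₀ h3' (by linarith), one_mul]
    have h4 : (t n : ℝ) ^ 4 ≤ n := by exact_mod_cast htn n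
    calc (t n : ℝ) ^ 2 * t n = (t n : ℝ) ^ 3 := by ring
      _ ≤ (t n : ℝ) ^ 4 := pow_le_pow_right₀ h2' (by norm_num)
      _ ≤ n := h4
  set D : ℝ := (3 + 2 * K + 2 * K ^ 2) + (3 + 2 * K + 2 * K ^ 2) ^ 2 with hD
  have hΦ : Tendsto (fun n => 1 - (1 - 4 * x n) ^ 2 / (Real.exp (8 * K / r * x n) *
      (1 + 8 * D / r ^ 2 * x n))) atTop (𝓝 0) := by
    have hcont : ContinuousAt (fun y : ℝ => 1 - (1 - 4 * y) ^ 2 / (Real.exp (8 * K / r * y) *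
        (1 + 8 * D / r ^ 2 * y))) 0 := by
      refine ContinuousAt.sub continuousAt_const (ContinuousAt.div (by fun_prop) (by fun_prop) ?_)
      simp
    have := hcont.tendsto.comp hx0
    simpa [Function.comp_def] using this
  have hgrow : ∀ᶠ s : ℕ in atTop, 2 * ((s : ℝ) + 1) ^ 4 ≤ (1 + ε) ^ s := by
    have h1 := tendsto_pow_const_div_const_pow_of_one_lt 4 (show 1 < 1 + ε by linarith)
    have h2 := h1.eventually (gt_mem_nhds (show (0 : ℝ) < 1 / 32 by norm_num))
    filter_upwards [h2, eventually_ge_atTop 1] with s h3 h4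
    have h4' : (1 : ℝ) ≤ s := by exact_mod_cast h4
    rw [div_lt_iff₀ (by positivity)] at h3
    have h5 : ((s : ℝ) + 1) ^ 4 ≤ (2 * s) ^ 4 := pow_le_pow_left₀ (by positivity) (by linarith) 4
    rw [mul_pow] at h5
    linarith
  have hθ : ∀ᶠ s : ℕ in atTop, 1 / (s : ℝ) ≤ ε / 2 :=
    tendsto_one_div_atTop_nhds_zero_nat.eventually (ge_mem_nhds (by positivity))
  filter_upwards [hΦ.eventually (ge_mem_nhds hη), httop.eventually hgrow, httop.eventually hθ,
    httop.eventually_ge_atTop 2, hx0.eventually (ge_mem_nhds (show (0 : ℝ) < 1 / 4 by norm_num)),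
    eventually_ge_atTop 2] with n h1 h2 h3 h4 h5 hn m hm
  have hn' : (2 : ℝ) ≤ n := by exact_mod_cast hn
  have hr4 : 4 * r ≤ 1 := by rw [hrdef]; nlinarith [sq_nonneg (2 * p - 1)]
  have hm' : (1 + ε) * n ≤ 4 * r * m := by
    have h6 : (1 + ε) * (1 / (4 * p * (1 - p))) * n = (1 + ε) * n / (4 * r) := by
      rw [hrdef]; field_simp
    rw [h6, div_le_iff₀ (by positivity)] at hm
    linarith
  have hnm : n ≤ m := by
    have h6 : 4 * r * m ≤ 1 * m := mul_le_mul_of_nonneg_right hr4 (by positivity)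
    have h7 : (n : ℝ) ≤ m := by nlinarith
    exact_mod_cast h7
  obtain ⟨k, hk⟩ : ∃ k, t n = k + 2 := ⟨t n - 2, by omega⟩
  have hγ : 1 + ε ≤ 2 * n * r * (m / (n.choose 2 : ℝ)) := by
    have h6 : 2 * n * r * (m / (n.choose 2 : ℝ)) = 4 * r * m / (n - 1) := by
      have : (n : ℝ) - 1 ≠ 0 := by linarith
      have : (n : ℝ) ≠ 0 := by linarith
      rw [Nat.cast_choose_two ℝ n]
      field_simp
      ring
    rw [h6, le_div_iff₀ (by linarith)]
    nlinarith
  refine le_trans (satProb_le_of_supercritical (k := k) (K := K) (x := x n) hn hnm hp0 hp1 hK0.le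
    rfl ?_ ?_ ?_ (by linarith)) h1
  · rw [← hk]
    calc _ ≤ (1 + ε / 2) * (1 + K) :=
          mul_le_mul_of_nonneg_right (by linarith) (by positivity)
      _ = K * (1 + ε) := by rw [hK]; field_simp; ring
      _ ≤ _ := mul_le_mul_of_nonneg_left hγ hK0.le
  · rw [← hk]
    have h6 : (n : ℝ) ≤ ((t n : ℝ) + 1) ^ 4 := by exact_mod_cast hnt n
    calc 2 * (n : ℝ) ≤ 2 * ((t n : ℝ) + 1) ^ 4 := by linarith
      _ ≤ (1 + ε) ^ t n := h2
      _ ≤ _ := pow_le_pow_left₀ (by positivity) hγ _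
  · rw [← hk]

/-! ### Poissonization -/

/-- The Poisson weights. -/
noncomputable def poissonWeight (t : ℝ) (m : ℕ) : ℝ := Real.exp (-t) * t ^ m / m.factorial

theorem hasSum_poissonWeight (t : ℝ≥0) : HasSum (poissonWeight t) 1 :=
  ProbabilityTheory.hasSum_one_poissonMeasure t

theorem poissonWeight_nonneg (t : ℝ≥0) (m : ℕ) : 0 ≤ poissonWeight t m := by
  unfold poissonWeight
  positivity

/-- This shift yields the first two moments, as the term m = 0 vanishes in both. -/
theorem poissonWeight_succ (t : ℝ) (m : ℕ) :
    ((m + 1 : ℕ) : ℝ) * poissonWeight t (m + 1) = t * poissonWeight t m := by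
  unfold poissonWeight
  rw [Nat.factorial_succ, Nat.cast_mul]
  have h1 : ((m + 1 : ℕ) : ℝ) ≠ 0 := by positivity
  have h2 : (m.factorial : ℝ) ≠ 0 := by positivity
  field_simp
  ring

theorem hasSum_mul_poissonWeight (t : ℝ≥0) : HasSum (fun m : ℕ => m * poissonWeight t m) t := by
  rw [← hasSum_nat_add_iff' 1]
  simp only [poissonWeight_succ]
  simpa using (hasSum_poissonWeight t).mul_left (t : ℝ)

theorem hasSum_sq_mul_poissonWeight (t : ℝ≥0) :
    HasSum (fun m : ℕ => (m : ℝ) ^ 2 * poissonWeight t m) ((t : ℝ) ^ 2 + t) := by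
  rw [← hasSum_nat_add_iff' 1]
  have h1 : ∀ m : ℕ, ((m + 1 : ℕ) : ℝ) ^ 2 * poissonWeight t (m + 1) =
      t * (m * poissonWeight t m) + t * poissonWeight t m := by
    intro m
    rw [sq, mul_assoc, poissonWeight_succ]
    push_cast
    ring
  simp only [h1]
  have h2 := ((hasSum_mul_poissonWeight t).mul_left (t : ℝ)).add
    ((hasSum_poissonWeight t).mul_left (t : ℝ))
  simpa [sq] using h2

theorem hasSum_poissonWeight_variance (t : ℝ≥0) :
    HasSum (fun m : ℕ => poissonWeight t m * ((m : ℝ) - t) ^ 2) t := by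
  have h := ((hasSum_sq_mul_poissonWeight t).sub
    ((hasSum_mul_poissonWeight t).mul_left (2 * (t : ℝ)))).add
    ((hasSum_poissonWeight t).mul_left ((t : ℝ) ^ 2))
  have h2 : ((t : ℝ) ^ 2 + t - 2 * t * t + (t : ℝ) ^ 2 * 1) = t := by ring
  rw [h2] at h
  have hfun : (fun m : ℕ => poissonWeight t m * ((m : ℝ) - t) ^ 2) = fun m : ℕ =>
      (m : ℝ) ^ 2 * poissonWeight t m - 2 * (t : ℝ) * (m * poissonWeight t m) +
        (t : ℝ) ^ 2 * poissonWeight t m := funext fun m => by ring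
  rw [hfun]
  exact h

theorem summable_satProbPoisson {n : ℕ} (hn : 2 ≤ n) {p : ℝ} (hp0 : 0 ≤ p) (hp1 : p ≤ 1)
    (t : ℝ≥0) : Summable fun m => poissonWeight t m * satProb 2 n m p :=
  Summable.of_nonneg_of_le
    (fun m => mul_nonneg (poissonWeight_nonneg t m) (satProb_nonneg hp0 hp1))
    (fun m => mul_le_of_le_one_right (poissonWeight_nonneg t m) (satProb_le_one hn hp0 hp1))
    (hasSum_poissonWeight t).summable

theorem satProbPoisson_le_one {n : ℕ} (hn : 2 ≤ n) {p : ℝ} (hp0 : 0 ≤ p) (hp1 : p ≤ 1)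
    (t : ℝ≥0) : satProbPoisson 2 n t p ≤ 1 := by
  rw [← (hasSum_poissonWeight t).tsum_eq]
  exact (summable_satProbPoisson hn hp0 hp1 t).tsum_le_tsum (fun m => mul_le_of_le_one_right
    (poissonWeight_nonneg t m) (satProb_le_one hn hp0 hp1)) (hasSum_poissonWeight t).summable

theorem satProbPoisson_nonneg {n : ℕ} {p : ℝ} (hp0 : 0 ≤ p) (hp1 : p ≤ 1)
    (t : ℝ≥0) : 0 ≤ satProbPoisson 2 n t p :=
  tsum_nonneg fun m => mul_nonneg (poissonWeight_nonneg t m) (satProb_nonneg hp0 hp1)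

theorem hasSum_poissonWeight_chebyshev (t : ℝ≥0) (A B : ℝ) :
    HasSum (fun m : ℕ => poissonWeight t m * (A + B * ((m : ℝ) - t) ^ 2)) (A + B * t) := by
  have h := ((hasSum_poissonWeight t).mul_left A).add
    ((hasSum_poissonWeight_variance t).mul_left B)
  rw [mul_one] at h
  have hfun : (fun m : ℕ => poissonWeight t m * (A + B * ((m : ℝ) - t) ^ 2)) = fun m : ℕ =>
      A * poissonWeight t m + B * (poissonWeight t m * ((m : ℝ) - t) ^ 2) :=
    funext fun m => by ring
  rw [hfun]
  exact h

/-- Chebyshev in pointwise form: the satisfiability probability is at most η + (m - t)²/d² for every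
m, and the Poisson variance is t. -/
theorem satProbPoisson_le {n : ℕ} (hn : 2 ≤ n) {p : ℝ} (hp0 : 0 ≤ p) (hp1 : p ≤ 1) {t : ℝ≥0}
    {M d η : ℝ} (hη : 0 ≤ η) (hd : 0 < d) (hM : M + d ≤ t)
    (h : ∀ m : ℕ, M ≤ m → satProb 2 n m p ≤ η) : satProbPoisson 2 n t p ≤ η + t / d ^ 2 := by
  have hs := hasSum_poissonWeight_chebyshev t η (1 / d ^ 2)
  rw [one_div_mul_eq_div] at hs
  rw [← hs.tsum_eq]
  refine (summable_satProbPoisson hn hp0 hp1 t).tsum_le_tsum (fun m =>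
    mul_le_mul_of_nonneg_left ?_ (poissonWeight_nonneg t m)) hs.summable
  rw [one_div_mul_eq_div]
  rcases le_or_gt M m with h1 | h1
  · exact (h m h1).trans (le_add_of_nonneg_right (by positivity))
  · have h2 : 1 ≤ ((m : ℝ) - t) ^ 2 / d ^ 2 := by
      rw [one_le_div (by positivity)]
      nlinarith
    linarith [satProb_le_one (m := m) hn hp0 hp1]

theorem le_satProbPoisson {n : ℕ} (hn : 2 ≤ n) {p : ℝ} (hp0 : 0 ≤ p) (hp1 : p ≤ 1) {t : ℝ≥0}
    {M d η : ℝ} (hη : 0 ≤ η) (hd : 0 < d) (hM : t + d ≤ M)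
    (h : ∀ m : ℕ, m ≤ M → 1 - η ≤ satProb 2 n m p) :
    1 - η - t / d ^ 2 ≤ satProbPoisson 2 n t p := by
  have hs := hasSum_poissonWeight_chebyshev t (1 - η) (-(1 / d ^ 2))
  rw [neg_mul, one_div_mul_eq_div, ← sub_eq_add_neg] at hs
  rw [← hs.tsum_eq]
  refine hs.summable.tsum_le_tsum (fun m => mul_le_mul_of_nonneg_left ?_
    (poissonWeight_nonneg t m)) (summable_satProbPoisson hn hp0 hp1 t)
  rw [neg_mul, one_div_mul_eq_div, ← sub_eq_add_neg]
  rcases le_or_gt (m : ℝ) M with h1 | h1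
  · exact (sub_le_self _ (by positivity)).trans (h m h1)
  · have h2 : 1 ≤ ((m : ℝ) - t) ^ 2 / d ^ 2 := by
      rw [one_le_div (by positivity)]
      nlinarith
    linarith [satProb_nonneg (n := n) (m := m) hp0 hp1]

/-! ### The threshold -/

theorem isSharpSatThreshold_two {p : ℝ} (hp0 : 0 < p) (hp1 : p < 1) :
    IsSharpSatThreshold 2 p (1 / (4 * p * (1 - p))) := by
  intro ε hε m
  constructor
  · intro hm
    refine tendsto_order.2 ⟨fun a ha => ?_, fun a ha => ?_⟩
    · filter_upwards [hm, eventually_le_satProb hp0 hp1 hε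
        (show 0 < (1 - a) / 2 by linarith)] with n h1 h2
      linarith [h2 _ h1]
    · filter_upwards [eventually_ge_atTop 2] with n hn
      exact (satProb_le_one hn hp0.le hp1.le).trans_lt ha
  · intro hm
    refine tendsto_order.2 ⟨fun a ha => ?_, fun a ha => ?_⟩
    · exact Eventually.of_forall fun n => ha.trans_le (satProb_nonneg hp0.le hp1.le)
    · filter_upwards [hm, eventually_satProb_le hp0 hp1 hε (half_pos ha)] with n h1 h2
      linarith [h2 _ h1]

theorem isSharpSatThresholdPoisson_two {p : ℝ} (hp0 : 0 < p) (hp1 : p < 1) :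
    IsSharpSatThresholdPoisson 2 p (1 / (4 * p * (1 - p))) := by
  have hα : 0 < 1 / (4 * p * (1 - p)) := by
    have : 0 < 1 - p := by linarith
    positivity
  set α := 1 / (4 * p * (1 - p)) with hαdef
  intro ε hε t
  constructor
  · intro hm
    refine tendsto_order.2 ⟨fun a ha => ?_, fun a ha => ?_⟩
    · have hη : 0 < (1 - a) / 3 := by linarith
      have hev : ∀ᶠ n : ℕ in atTop, 1 / ((ε / 2) ^ 2 * α * ((1 - a) / 3)) ≤ (n : ℝ) :=
        tendsto_natCast_atTop_atTop.eventually_ge_atTop _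
      filter_upwards [hm, eventually_le_satProb hp0 hp1 (half_pos hε) hη, hev,
        eventually_ge_atTop 2] with n h1 h2 h3 hn
      have hn0 : (0 : ℝ) < n := by exact_mod_cast (by omega : 0 < n)
      have h4 := le_satProbPoisson hn hp0.le hp1.le (t := t n) (M := (1 - ε / 2) * α * n)
        (d := ε / 2 * α * n) hη.le (by positivity) (by linarith) h2
      have h5 : (t n : ℝ) / (ε / 2 * α * n) ^ 2 ≤ (1 - a) / 3 := by
        rw [div_le_iff₀ (by positivity)]
        rw [div_le_iff₀ (by positivity)] at h3
        have h6 : (t n : ℝ) ≤ α * n := by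
          have : 0 ≤ ε * α * n := by positivity
          linarith
        have h7 := mul_le_mul_of_nonneg_left h3 (show 0 ≤ α * n by positivity)
        linarith
      linarith
    · filter_upwards [eventually_ge_atTop 2] with n hn
      exact (satProbPoisson_le_one hn hp0.le hp1.le _).trans_lt ha
  · intro hm
    refine tendsto_order.2 ⟨fun a ha => ?_, fun a ha => ?_⟩
    · exact Eventually.of_forall fun n => ha.trans_le (satProbPoisson_nonneg hp0.le hp1.le _)
    · have hη : 0 < a / 3 := by linarith
      -- Chosen so that (1 - δ)(1 + ε) = 1 + ε/2. The deviation δ t is proportional to t rather than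
      -- n, because t(n) has no upper bound here.
      set δ : ℝ := ε / 2 / (1 + ε) with hδ
      have hδ0 : 0 < δ := by positivity
      have hev : ∀ᶠ n : ℕ in atTop, 1 / (δ ^ 2 * α * (a / 3)) ≤ (n : ℝ) :=
        tendsto_natCast_atTop_atTop.eventually_ge_atTop _
      filter_upwards [hm, eventually_satProb_le hp0 hp1 (half_pos hε) hη, hev,
        eventually_ge_atTop 2] with n h1 h2 h3 hn
      have hn0 : (0 : ℝ) < n := by exact_mod_cast (by omega : 0 < n)
      have hαn : 0 < α * n := by positivity
      have ht : α * n ≤ t n := by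
        have : 0 ≤ ε * α * n := by positivity
        linarith
      have ht0 : (0 : ℝ) < t n := hαn.trans_le ht
      have hM : (1 + ε / 2) * α * n + δ * t n ≤ t n := by
        have h5 : (1 + ε / 2) * α * n = (1 - δ) * ((1 + ε) * α * n) := by
          rw [hδ]; field_simp; ring
        have h6 : 0 ≤ 1 - δ := by
          rw [hδ, sub_nonneg, div_le_one (by positivity)]
          linarith
        have h7 := mul_le_mul_of_nonneg_left h1 h6
        rw [h5]
        linarith
      have h4 := satProbPoisson_le hn hp0.le hp1.le (t := t n) (M := (1 + ε / 2) * α * n)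
        (d := δ * t n) hη.le (by positivity) hM h2
      have h5 : (t n : ℝ) / (δ * t n) ^ 2 ≤ a / 3 := by
        rw [div_le_iff₀ (by positivity)]
        rw [div_le_iff₀ (by positivity)] at h3
        have h6 : 1 ≤ δ ^ 2 * (a / 3) * t n := by
          have := mul_le_mul_of_nonneg_left ht (show 0 ≤ δ ^ 2 * (a / 3) by positivity)
          linarith
        have h7 := mul_le_mul_of_nonneg_left h6 ht0.le
        linarith
      linarith

theorem tendsto_medianDensity_two {p : ℝ} (hp0 : 0 < p) (hp1 : p < 1) :
    Tendsto (fun n : ℕ => medianDensity 2 p n) atTop (𝓝 (1 / (4 * p * (1 - p)))) := by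
  have hα : 0 < 1 / (4 * p * (1 - p)) := by
    have : 0 < 1 - p := by linarith
    positivity
  have hsub := fun ε hε => eventually_le_satProb hp0 hp1 (ε := ε) hε
    (show (0 : ℝ) < 1 / 4 by norm_num)
  have hsup := fun ε hε => eventually_satProb_le hp0 hp1 (ε := ε) hε
    (show (0 : ℝ) < 1 / 2 by norm_num)
  set α := 1 / (4 * p * (1 - p)) with hαdef
  have hmem : ∀ n : ℕ, ∀ ε : ℝ, (∀ m : ℕ, (1 + ε) * α * n ≤ (m : ℝ) → satProb 2 n m p ≤ 1 / 2) →
      ((⌈(1 + ε) * α * n⌉₊ : ℕ) : ℝ) / n ∈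
        {β : ℝ | ∃ m : ℕ, β = (m : ℝ) / (n : ℝ) ∧ satProb 2 n m p ≤ 1 / 2} :=
    fun n ε h => ⟨_, rfl, h _ (Nat.le_ceil _)⟩
  refine tendsto_order.2 ⟨fun a ha => ?_, fun a ha => ?_⟩
  · set ε : ℝ := (α - a) / (2 * α) with hε
    have hε0 : 0 < ε := div_pos (by linarith) (by positivity)
    have hεα : ε * α = (α - a) / 2 := by rw [hε]; field_simp
    filter_upwards [hsub ε hε0, hsup 1 one_pos, eventually_ge_atTop 1] with n h1 h2 hn
    have hn0 : (0 : ℝ) < n := by exact_mod_cast hn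
    refine lt_of_lt_of_le (show a < (1 - ε) * α by linarith) ?_
    -- Nonemptiness matters: the infimum of the empty set would be 0 by convention.
    refine le_csInf ⟨_, hmem n 1 h2⟩ ?_
    rintro β ⟨m, rfl, hm⟩
    by_contra! h3
    rw [div_lt_iff₀ hn0] at h3
    linarith [h1 m h3.le]
  · set ε : ℝ := (a - α) / (2 * α) with hε
    have hε0 : 0 < ε := div_pos (by linarith) (by positivity)
    have hεα : ε * α = (a - α) / 2 := by rw [hε]; field_simp
    -- Rounding m up moves the density by less than 1/n, which must fit in the remaining half of the
    -- gap a - α.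
    have hev : ∀ᶠ n : ℕ in atTop, 1 / ((a - α) / 2) < (n : ℝ) :=
      tendsto_natCast_atTop_atTop.eventually_gt_atTop _
    filter_upwards [hsup ε hε0, hev, eventually_ge_atTop 1] with n h1 h2 hn
    have hn0 : (0 : ℝ) < n := by exact_mod_cast hn
    have hbdd : BddBelow {β : ℝ | ∃ m : ℕ, β = (m : ℝ) / (n : ℝ) ∧ satProb 2 n m p ≤ 1 / 2} := by
      refine ⟨0, ?_⟩
      rintro β ⟨m, rfl, -⟩
      positivity
    refine (csInf_le hbdd (hmem n ε h1)).trans_lt ?_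
    rw [div_lt_iff₀ hn0]
    rw [div_lt_iff₀ (by linarith)] at h2
    have h3 := Nat.ceil_lt_add_one (show 0 ≤ (1 + ε) * α * n by positivity)
    have h4 : (1 + ε) * α * n = (α + (a - α) / 2) * n := by rw [← hεα]; ring
    linarith

theorem mainTheorem2 (p b : ℝ) (hp0 : 0 < p) (hp1 : p < 1) (hb : p = 1 / 2 - b) :
    IsSharpSatThreshold 2 p (1 / (4 * p * (1 - p))) ∧
    IsSharpSatThresholdPoisson 2 p (1 / (4 * p * (1 - p))) ∧
    Tendsto (fun n : ℕ => medianDensity 2 p n) atTop (𝓝 (1 / (4 * p * (1 - p)))) ∧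
    1 / (4 * p * (1 - p)) = 1 / (1 - 4 * b ^ 2) := by
  refine ⟨isSharpSatThreshold_two hp0 hp1, isSharpSatThresholdPoisson_two hp0 hp1,
    tendsto_medianDensity_two hp0 hp1, ?_⟩
  congr 1
  rw [hb]
  ring
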